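/- For $\tau\in\mathbb{R}$ define the greedy approximation to $\tau$ by signed harmonic sums recursively by $\sigma_0(\tau):=0$ and, for $n\ge 1$, $$s_n(\tau):=\begin{cases}1,&\text{if }\tau\ge\sigma_{n-1}(\tau),\\-1,&\text{if }\tau<\sigma_{n-1}(\tau),\end{cases}\qquad \sigma_n(\tau):=\sum_{m=1}^n\frac{s_m(\tau)}{m}.$$ Then for Lebesgue-almost every $\tau\in\mathbb{R}$ one has $$\liminf_{n\to\infty}\frac{\log|\tau-\sigma_n(\tau)|}{(\log n)^2}=-\frac{1}{\log 4},$$ and moreover, in the following stronger form, $$0\le\liminf_{m\to\infty}\frac{\log|\tau-\sigma_{m-1}(\tau)|+\frac{1}{\log 4}(\log m)^2}{\log m\,\log\log m}\le\frac{1}{\log 2}.$$ -/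

import Mathlib

open Filter MeasureTheory

/-- The next sign of the greedy algorithm with target `τ` when the current partial sum is `σ`:
it is `1` if `τ ≥ σ` and `-1` if `τ < σ`. -/
noncomputable def greedySign (τ σ : ℝ) : ℝ := if σ ≤ τ then 1 else -1

/-- The partial sums `σ_n(τ) = ∑_{m=1}^n s_m(τ) / m` of the greedy approximation to `τ` by signed
harmonic sums, where `s_m(τ)` is `greedySign τ σ_{m-1}(τ)` and `σ_0(τ) = 0`. -/
noncomputable def greedySum (τ : ℝ) : ℕ → ℝ
  | 0 => 0
  | n + 1 => greedySum τ n + greedySign τ (greedySum τ n) / ((n : ℝ) + 1)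

/-!
The absolute errors `a_n = |τ - σ_n(τ)|` satisfy `a_{n+1} = |a_n - 1 / (n + 1)|`
(`abs_sub_greedySum`), so the signs disappear and `τ ↦ a_n` is a piecewise isometry. Let `f_k(n)` be
the Thue–Morse difference `tmDiff k n`, where `f_0(n) = 1 / (n + 1)` and
`f_{k+1}(n) = f_k(n) - f_k(n + 2^k)`; it has the size of `2^(k(k-1)/2) k! / n^(k+1)`. As long as
`n ≥ regularTime k`, which is of size `k 2^k`, an error `a ≤ f_k(n)` is followed by Thue–Morse blocks
of signs: after `2^(k+1)` steps it has become `|a - f_{k+1}(n)|` (`foldOrbit_block`), and if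
`a ≤ f_k(n) / 2`, then it does not vanish inside this block (`foldOrbit_pos_of_lt`). For `n` near `regularTime k` the value
`f_k(n)` is `exp(-(log n)² / log 4 + (1 / log 2 + o(1)) log n log log n)`.

Upper bound. Call an error at time `n` of order `k + 1` if it is at most
`S_k(n) = ∑_i f_{k+1}(n + i 2^(k+1))`. The identities `S_k(n) = f_{k+1}(n) + S_k(n + 2^(k+1))` and
`S_{k+1}(n) + S_{k+1}(n + 2^(k+1)) = f_{k+1}(n)` show that under the dynamics the interval
`[0, S_k(n)]` decomposes exactly into isometric copies of intervals `[0, S_{k+1}(n')]` at later times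
`n'` (`volume_lateSet_le`). Hence with respect to Lebesgue measure the order rises from `k + 1` to
`k + 2` before time `3n/2`, up to a probability at most `4 (4/5)^(k+1)`. Since `3/2 < 2`, the order
catches up with the time: the orbit reaches order `k + 1` before `regularTime k` for some `k`. The
failure probability from order `k + 1` on is `O((4/5)^k)`, and bounds the failure probability from
order `1` on for every `k`, so the latter is zero (`volume_lateSet_eq_zero`). Null sets pull back to
null sets of targets, and this holds from any starting time, so that almost every target has
infinitely many such times (`ae_frequently_le_tailSum`).

Lower bound. An interval of targets on which `a_n` is an isometry is cut where `a_n` hits `0`. After a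
cut both pieces have small errors, which follow a Thue–Morse block; so a short interval is cut at most
once within `2^(k+1)` steps (`IsFoldPiece.exists_cut`). Counting windows of this length,
the number of pieces of `[-A, A]` at time `n` is at most `exp((log n)² / log 4 + O(log n))`
(`exists_hasCuts_exp`), and the Borel–Cantelli lemma applies to the events
`a_n ≤ exp(-(log n)² / log 4 - ε log n log log n)`.
-/

open scoped Nat

/-! ### Thue–Morse differences of the harmonic sequence -/

/-- The Thue–Morse difference `∑_{j < 2^k} t_j / (n + 1 + j)` of the harmonic sequence, where `t` is
the `±1` Thue–Morse sequence, defined through its doubling recursion. -/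
noncomputable def tmDiff : ℕ → ℕ → ℝ
  | 0, n => 1 / ((n : ℝ) + 1)
  | k + 1, n => tmDiff k n - tmDiff k (n + 2 ^ k)

/-- The difference `(1 - E) ^ j (tmDiff k)`, where `E` is the shift by one. The factorization
`1 - E ^ (2 ^ k) = (1 + E + ⋯ + E ^ (2 ^ k - 1)) (1 - E)` turns it into a sum with positive terms of
values of the explicit differences `(1 - E) ^ (k + j)` of the harmonic sequence. -/
noncomputable def mixDiff : ℕ → ℕ → ℕ → ℝ
  | 0, j, n => (j ! : ℝ) * n ! / (n + j + 1)!
  | k + 1, j, n => ∑ u ∈ Finset.range (2 ^ k), mixDiff k (j + 1) (n + u)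

theorem mixDiff_sub (k j n : ℕ) :
    mixDiff k j n - mixDiff k j (n + 1) = mixDiff k (j + 1) n := by
  induction k generalizing j n with
  | zero =>
    simp only [mixDiff]
    rw [show n + 1 + j + 1 = n + j + 1 + 1 by ring, show n + (j + 1) + 1 = n + j + 1 + 1 by ring,
      Nat.factorial_succ (n + j + 1), Nat.factorial_succ n, Nat.factorial_succ j]
    have h : ((n + j + 1)! : ℝ) ≠ 0 := by positivity
    have h' : ((n : ℝ) + j + 1 + 1) ≠ 0 := by positivity
    push_cast
    field_simp
    ring
  | succ k ih =>
    simp only [mixDiff]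
    rw [← Finset.sum_sub_distrib]
    refine Finset.sum_congr rfl fun u _ => ?_
    rw [show n + 1 + u = n + u + 1 by ring, ih]

theorem sum_mixDiff (k j n N : ℕ) :
    ∑ u ∈ Finset.range N, mixDiff k (j + 1) (n + u) = mixDiff k j n - mixDiff k j (n + N) := by
  induction N with
  | zero => simp
  | succ N ih => rw [Finset.sum_range_succ, ih, ← mixDiff_sub, ← add_assoc]; ring

theorem mixDiff_zero_right (k n : ℕ) : mixDiff k 0 n = tmDiff k n := by
  induction k generalizing n with
  | zero =>
    simp only [mixDiff, tmDiff, Nat.factorial_zero, Nat.add_zero, Nat.factorial_succ]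
    have h : (n ! : ℝ) ≠ 0 := by positivity
    push_cast
    field_simp
  | succ k ih => rw [mixDiff, sum_mixDiff, ih, ih, tmDiff]

theorem mixDiff_pos (k j n : ℕ) : 0 < mixDiff k j n := by
  induction k generalizing j n with
  | zero => simp only [mixDiff]; positivity
  | succ k ih => exact Finset.sum_pos (fun u _ => ih _ _) (by simp)

theorem mixDiff_antitone (k j : ℕ) : Antitone (mixDiff k j) :=
  antitone_nat_of_succ_le fun n => by
    have := mixDiff_sub k j n
    have := mixDiff_pos k (j + 1) n
    linarith

theorem tmDiff_pos (k n : ℕ) : 0 < tmDiff k n := mixDiff_zero_right k n ▸ mixDiff_pos k 0 n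

theorem tmDiff_antitone (k : ℕ) : Antitone (tmDiff k) := fun m n h => by
  simpa only [mixDiff_zero_right] using mixDiff_antitone k 0 h

theorem tmDiff_succ_le (k n : ℕ) : tmDiff (k + 1) n ≤ tmDiff k n := by
  have := tmDiff_pos k (n + 2 ^ k)
  rw [tmDiff]; linarith

/-- The differences decay at most as fast as the power `-(k + j + 1)`. -/
theorem mul_mixDiff_le (k j n : ℕ) :
    ((n : ℝ) + 1) * mixDiff k j n ≤ ((n : ℝ) + k + j + 2) * mixDiff k j (n + 1) := by
  induction k generalizing j n with
  | zero =>
    simp only [mixDiff]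
    rw [show n + 1 + j + 1 = n + j + 1 + 1 by ring, Nat.factorial_succ (n + j + 1),
      Nat.factorial_succ n]
    have h : ((n + j + 1)! : ℝ) ≠ 0 := by positivity
    have h' : ((n : ℝ) + j + 1 + 1) ≠ 0 := by positivity
    push_cast
    field_simp
    apply le_of_eq
    ring
  | succ k ih =>
    simp only [mixDiff, Finset.mul_sum]
    refine Finset.sum_le_sum fun u _ => ?_
    have h1 := ih (j + 1) (n + u)
    have h2 := mixDiff_antitone k (j + 1) (Nat.le_succ (n + u))
    rw [show n + 1 + u = n + u + 1 by ring]
    push_cast at h1 ⊢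
    have h3 : (u : ℝ) * mixDiff k (j + 1) (n + u + 1) ≤ u * mixDiff k (j + 1) (n + u) := by
      gcongr
    linarith

theorem mixDiff_le (k j n : ℕ) :
    mixDiff k j n ≤ 2 ^ k.choose 2 * (k + j)! / ((n : ℝ) + 1) ^ (k + j + 1) := by
  induction k generalizing j n with
  | zero =>
    simp only [mixDiff, Nat.choose_zero_succ, pow_zero, one_mul, zero_add]
    rw [div_le_div_iff₀ (by positivity) (by positivity), mul_assoc]
    have := @Nat.factorial_mul_pow_le_factorial n (j + 1)
    gcongr
    exact_mod_cast this
  | succ k ih =>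
    simp only [mixDiff]
    calc ∑ u ∈ Finset.range (2 ^ k), mixDiff k (j + 1) (n + u)
        ≤ ∑ u ∈ Finset.range (2 ^ k), mixDiff k (j + 1) n :=
          Finset.sum_le_sum fun u _ => mixDiff_antitone _ _ (Nat.le_add_right _ _)
      _ = 2 ^ k * mixDiff k (j + 1) n := by simp
      _ ≤ 2 ^ k * (2 ^ k.choose 2 * (k + (j + 1))! / ((n : ℝ) + 1) ^ (k + (j + 1) + 1)) := by
          gcongr; exact ih _ _
      _ = _ := by
          rw [show k + 1 + j = k + (j + 1) by ring, show (k + 1).choose 2 = k + k.choose 2 by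
            rw [Nat.choose_succ_succ' k 1, Nat.choose_one_right], pow_add]
          ring

theorem le_mixDiff (k j n : ℕ) :
    2 ^ k.choose 2 * (k + j)! / ((n : ℝ) + 2 ^ k + k + j) ^ (k + j + 1) ≤ mixDiff k j n := by
  induction k generalizing j n with
  | zero =>
    simp only [mixDiff, Nat.choose_zero_succ, pow_zero, one_mul, zero_add]
    rw [div_le_div_iff₀ (by positivity) (by positivity), mul_assoc]
    have h : (n + (j + 1))! ≤ n ! * (n + (j + 1)) ^ (j + 1) := by
      rw [← Nat.factorial_mul_ascFactorial]
      gcongr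
      exact Nat.ascFactorial_le_pow_add _ _
    gcongr
    have h' : ((n + (j + 1))! : ℝ) ≤ n ! * ((n : ℝ) + (j + 1)) ^ (j + 1) := by exact_mod_cast h
    rw [← add_assoc] at h'
    refine h'.trans (le_of_eq ?_)
    push_cast; ring
  | succ k ih =>
    simp only [mixDiff]
    calc _ = ∑ u ∈ Finset.range (2 ^ k), (2 ^ k.choose 2 * (k + (j + 1))! /
              ((n : ℝ) + 2 ^ (k + 1) + (k + 1 : ℕ) + j) ^ (k + (j + 1) + 1) : ℝ) := by
          rw [show k + 1 + j = k + (j + 1) by ring, show (k + 1).choose 2 = k + k.choose 2 by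
            rw [Nat.choose_succ_succ' k 1, Nat.choose_one_right], pow_add,
            Finset.sum_const, Finset.card_range, nsmul_eq_mul]
          push_cast
          ring
      _ ≤ _ := by
          refine Finset.sum_le_sum fun u hu => le_trans ?_ (ih (j + 1) (n + u))
          have hu' : (u : ℝ) ≤ 2 ^ k := by
            exact_mod_cast (Finset.mem_range.1 hu).le
          have h : ((n + u : ℕ) : ℝ) + 2 ^ k + k + (j + 1 : ℕ) ≤
              (n : ℝ) + 2 ^ (k + 1) + (k + 1 : ℕ) + j := by
            push_cast
            rw [pow_succ]
            linarith
          gcongr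

theorem tmDiff_le (k n : ℕ) : tmDiff k n ≤ 2 ^ k.choose 2 * k ! / ((n : ℝ) + 1) ^ (k + 1) := by
  simpa [mixDiff_zero_right] using mixDiff_le k 0 n

theorem le_tmDiff (k n : ℕ) :
    2 ^ k.choose 2 * k ! / ((n : ℝ) + 2 ^ k + k) ^ (k + 1) ≤ tmDiff k n := by
  simpa [mixDiff_zero_right] using le_mixDiff k 0 n

/-- The bound for the drop of `tmDiff k` over `h` steps that the decay rate gives. -/
theorem tmDiff_sub_le (k n h : ℕ) :
    tmDiff k n - tmDiff k (n + h) ≤ h * ((k + 1) / ((n : ℝ) + 1) * tmDiff k n) := by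
  have h1 : mixDiff k 1 n ≤ (k + 1) / ((n : ℝ) + 1) * tmDiff k n := by
    have h2 := mul_mixDiff_le k 0 n
    have h3 := mixDiff_sub k 0 n
    have h4 := mixDiff_antitone k 0 (Nat.le_succ n)
    have h5 : ((k : ℝ) + 1) * mixDiff k 0 (n + 1) ≤ (k + 1) * mixDiff k 0 n := by gcongr
    rw [← mixDiff_zero_right, div_mul_eq_mul_div, le_div_iff₀ (by positivity), ← zero_add 1, ← h3]
    push_cast at h2 ⊢
    linarith
  rw [← mixDiff_zero_right, ← mixDiff_zero_right, ← sum_mixDiff, mixDiff_zero_right]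
  calc ∑ u ∈ Finset.range h, mixDiff k (0 + 1) (n + u)
      ≤ ∑ u ∈ Finset.range h, mixDiff k 1 n :=
        Finset.sum_le_sum fun u _ => mixDiff_antitone _ _ (Nat.le_add_right _ _)
    _ = h * mixDiff k 1 n := by simp
    _ ≤ _ := by gcongr

/-- From time `regularTime k` on, the Thue–Morse differences of order `k + 1` are small compared with
those of order `k`. -/
def regularTime (k : ℕ) : ℕ := (k + 1) * 2 ^ (k + 2)

theorem regularTime_strictMono : StrictMono regularTime :=
  strictMono_nat_of_lt_succ fun k => by
    simp only [regularTime]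
    have h : 0 < 2 ^ (k + 2) := by positivity
    rw [pow_succ 2 (k + 1 + 1)]
    nlinarith

theorem tmDiff_succ_le_half {k n : ℕ} (h : regularTime k ≤ n + 1) :
    tmDiff (k + 1) n ≤ tmDiff k (n + 2 ^ (k + 1)) / 2 := by
  have h1 := tmDiff_sub_le k n (2 ^ k)
  have h2 := tmDiff_sub_le k n (2 ^ (k + 1))
  have hp := tmDiff_pos k n
  have h3 : ((k : ℝ) + 1) * 2 ^ (k + 2) ≤ n + 1 := by exact_mod_cast h
  have h4 : (2 : ℝ) ^ k * ((k + 1) / ((n : ℝ) + 1)) ≤ 1 / 4 := by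
    rw [mul_div_assoc', div_le_div_iff₀ (by positivity) (by positivity)]
    rw [pow_add] at h3
    linarith
  have h5 : (2 : ℝ) ^ k * ((k + 1) / ((n : ℝ) + 1) * tmDiff k n) ≤ 1 / 4 * tmDiff k n := by
    rw [← mul_assoc]; gcongr
  push_cast at h1 h2
  rw [pow_succ (2 : ℝ)] at h2
  rw [tmDiff]
  linarith

/-! ### The folding dynamics of the absolute error -/

/-- The absolute error `m` steps after time `n` when it is `a` at time `n`: each step of the greedy
algorithm replaces the absolute error `x` at time `i` by `|x - 1 / (i + 1)|`. -/
noncomputable def foldOrbit (n : ℕ) (a : ℝ) : ℕ → ℝ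
  | 0 => a
  | m + 1 => |foldOrbit n a m - tmDiff 0 (n + m)|

theorem foldOrbit_add (n : ℕ) (a : ℝ) (m l : ℕ) :
    foldOrbit n a (m + l) = foldOrbit (n + m) (foldOrbit n a m) l := by
  induction l with
  | zero => rfl
  | succ l ih => rw [← add_assoc, foldOrbit, ih, foldOrbit, add_assoc]

theorem foldOrbit_nonneg {n : ℕ} {a : ℝ} (ha : 0 ≤ a) (m : ℕ) : 0 ≤ foldOrbit n a m := by
  cases m with
  | zero => exact ha
  | succ m => exact abs_nonneg _

theorem abs_sub_greedySum (τ : ℝ) (n : ℕ) : |τ - greedySum τ n| = foldOrbit 0 |τ| n := by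
  induction n with
  | zero => simp [greedySum, foldOrbit]
  | succ n ih =>
    rw [foldOrbit, ← ih, greedySum, greedySign, zero_add, tmDiff]
    split_ifs with h
    · rw [abs_of_nonneg (sub_nonneg.2 h)]
      ring_nf
    · rw [abs_of_neg (sub_neg.2 (not_le.1 h)), ← abs_neg]
      ring_nf

/-- In the regular regime, `2 ^ (k + 1)` steps of the dynamics from an error below `tmDiff k n` use
the signs of a Thue–Morse block, and so amount to a single fold at `tmDiff (k + 1) n`. -/
theorem foldOrbit_block {k n : ℕ} {a : ℝ} (ha0 : 0 ≤ a) (ha : a ≤ tmDiff k n)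
    (hn : ∀ j < k, regularTime j ≤ n + 1) :
    foldOrbit n a (2 ^ (k + 1)) = |a - tmDiff (k + 1) n| := by
  induction k generalizing n a with
  | zero =>
    change |(|a - tmDiff 0 n|) - tmDiff 0 (n + 1)| = |a - (tmDiff 0 n - tmDiff 0 (n + 2 ^ 0))|
    rw [abs_of_nonpos (sub_nonpos.2 ha), ← abs_neg]
    ring_nf
  | succ k ih =>
    have hk : ∀ j < k, regularTime j ≤ n + 1 := fun j hj => hn j (by omega)
    have h1 := ih ha0 (ha.trans (tmDiff_succ_le k n)) hk
    rw [abs_of_nonpos (sub_nonpos.2 ha), neg_sub] at h1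
    have h2 := tmDiff_succ_le_half (hn k (by omega))
    have h3 := tmDiff_pos k (n + 2 ^ (k + 1))
    change _ = |a - (tmDiff (k + 1) n - tmDiff (k + 1) (n + 2 ^ (k + 1)))|
    rw [pow_succ 2 (k + 1), mul_two, foldOrbit_add, h1, ih (sub_nonneg.2 ha) (by linarith)
      fun j hj => (hk j hj).trans (by gcongr; exact Nat.le_add_right _ _), ← abs_neg]
    congr 1
    ring

/-- In the regular regime, the error cannot vanish in the interior of a Thue–Morse block. -/
theorem foldOrbit_pos_of_lt {k n : ℕ} {a : ℝ} (ha0 : 0 ≤ a) (ha : a ≤ tmDiff k n / 2)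
    (hn : ∀ j < k, regularTime j ≤ n + 1) {m : ℕ} (hm0 : 0 < m) (hm : m < 2 ^ (k + 1)) :
    0 < foldOrbit n a m := by
  induction k generalizing n a m with
  | zero =>
    obtain rfl : m = 1 := by simp at hm; omega
    have := tmDiff_pos 0 n
    change 0 < |a - tmDiff 0 n|
    exact abs_pos.2 (by linarith)
  | succ k ih =>
    have hk : ∀ j < k, regularTime j ≤ n + 1 := fun j hj => hn j (by omega)
    have h0 := tmDiff_pos (k + 1) n
    have h1 := tmDiff_succ_le k n
    have h2 := foldOrbit_block ha0 (by linarith) hk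
    rw [abs_of_nonpos (by linarith), neg_sub] at h2
    have h3 := tmDiff_succ_le_half (hn k (by omega))
    obtain h | rfl | h := lt_trichotomy m (2 ^ (k + 1))
    · exact ih ha0 (by linarith) hk hm0 h
    · rw [h2]; linarith
    · obtain ⟨l, rfl⟩ := Nat.exists_eq_add_of_lt h
      rw [pow_succ 2 (k + 1)] at hm
      rw [add_assoc, foldOrbit_add, h2]
      exact ih (by linarith) (by linarith)
        (fun j hj => (hk j hj).trans (by gcongr; exact Nat.le_add_right _ _)) (by omega) (by omega)

/-! ### Tail sums of the Thue–Morse differences -/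

/-- The total distance that the error can be moved by Thue–Morse blocks of length `2 ^ (k + 1)` that
follow each other from time `n` on. An error at time `n` that is at most `tailSum k n` is said to be of
order `k + 1`. -/
noncomputable def tailSum (k n : ℕ) : ℝ := ∑' i : ℕ, tmDiff (k + 1) (n + i * 2 ^ (k + 1))

theorem sum_tmDiff_le (k n N : ℕ) :
    ∑ i ∈ Finset.range N, tmDiff (k + 1) (n + i * 2 ^ (k + 1)) ≤
      tmDiff k n - tmDiff k (n + N * 2 ^ (k + 1)) := by
  induction N with
  | zero => simp
  | succ N ih =>
    rw [Finset.sum_range_succ, tmDiff]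
    have : tmDiff k (n + (N + 1) * 2 ^ (k + 1)) ≤ tmDiff k (n + N * 2 ^ (k + 1) + 2 ^ k) :=
      tmDiff_antitone k (by rw [pow_succ]; nlinarith [pow_pos (two_pos (α := ℕ)) k])
    linarith

theorem summable_tmDiff (k n : ℕ) :
    Summable fun i : ℕ => tmDiff (k + 1) (n + i * 2 ^ (k + 1)) :=
  summable_of_sum_range_le (c := tmDiff k n) (fun _ => (tmDiff_pos _ _).le) fun N => by
    have := sum_tmDiff_le k n N
    have := tmDiff_pos k (n + N * 2 ^ (k + 1))
    linarith

theorem tailSum_eq (k n : ℕ) :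
    tailSum k n = tmDiff (k + 1) n + tailSum k (n + 2 ^ (k + 1)) := by
  rw [tailSum, (summable_tmDiff k n).tsum_eq_zero_add, tailSum]
  simp only [zero_mul, add_zero]
  congr 2
  ext i
  congr 1
  ring

theorem tailSum_pos (k n : ℕ) : 0 < tailSum k n :=
  (summable_tmDiff k n).tsum_pos (fun _ => (tmDiff_pos _ _).le) 0 (tmDiff_pos _ _)

theorem tailSum_antitone (k : ℕ) : Antitone (tailSum k) := fun m n h =>
  (summable_tmDiff k n).tsum_le_tsum (fun _ => tmDiff_antitone _ (by gcongr)) (summable_tmDiff k m)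

theorem tendsto_tmDiff (k : ℕ) : Tendsto (tmDiff k) atTop (nhds 0) := by
  refine squeeze_zero (fun n => (tmDiff_pos k n).le) (g := fun n : ℕ => 1 / ((n : ℝ) + 1))
    (fun n => ?_) tendsto_one_div_add_atTop_nhds_zero_nat
  induction k with
  | zero => exact le_rfl
  | succ k ih => exact (tmDiff_succ_le k n).trans ih

/-- The tail sums of order `k + 1` solve the alternating recursion that splits the range of errors
below `tmDiff k n` into two parts exchanged by a Thue–Morse block of order `k`. -/
theorem tailSum_add (k n : ℕ) : tailSum k n + tailSum k (n + 2 ^ k) = tmDiff k n := by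
  have h1 := ((summable_tmDiff k n).hasSum.add (summable_tmDiff k (n + 2 ^ k)).hasSum).tendsto_sum_nat
  have h2 : ∀ N, ∑ i ∈ Finset.range N, (tmDiff (k + 1) (n + i * 2 ^ (k + 1)) +
      tmDiff (k + 1) (n + 2 ^ k + i * 2 ^ (k + 1))) =
        tmDiff k n - tmDiff k (n + N * 2 ^ (k + 1)) := by
    intro N
    induction N with
    | zero => simp
    | succ N ih =>
      rw [Finset.sum_range_succ, ih, tmDiff, tmDiff,
        show n + 2 ^ k + N * 2 ^ (k + 1) = n + N * 2 ^ (k + 1) + 2 ^ k by ring,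
        show n + (N + 1) * 2 ^ (k + 1) = n + N * 2 ^ (k + 1) + 2 ^ k + 2 ^ k by ring]
      ring
  simp only [h2] at h1
  have h3 : Tendsto (fun N : ℕ => n + N * 2 ^ (k + 1)) atTop atTop :=
    tendsto_atTop_mono (fun N => (Nat.le_mul_of_pos_right N (by positivity)).trans
      (Nat.le_add_left _ n)) tendsto_id
  have h4 := ((tendsto_tmDiff k).comp h3).const_sub (tmDiff k n)
  rw [sub_zero] at h4
  exact tendsto_nhds_unique h1 h4

theorem tailSum_le (k n : ℕ) : tailSum k n ≤ tmDiff k n := by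
  have := tailSum_add k n
  have := tailSum_pos k (n + 2 ^ k)
  linarith

theorem half_tmDiff_le_tailSum (k n : ℕ) : tmDiff k n / 2 ≤ tailSum k n := by
  have := tailSum_add k n
  have := tailSum_antitone k (Nat.le_add_right n (2 ^ k))
  linarith

theorem tailSum_antitone_left (n : ℕ) : Antitone fun k => tailSum k n :=
  antitone_nat_of_succ_le fun k => by
    have := tailSum_le (k + 1) n
    have := tailSum_eq k n
    have := tailSum_pos k (n + 2 ^ (k + 1))
    linarith

/-! ### Almost every orbit is infinitely often of a high order -/

/-- The errors `a` at time `n` whose orbit does not attain any order `k + 1` by the time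
`regularTime k`. -/
def lateSet (n : ℕ) : Set ℝ :=
  {a | 0 ≤ a ∧ ∀ m k, n + m + 1 ≤ regularTime k → tailSum k (n + m) < foldOrbit n a m}

theorem foldOrbit_mem_lateSet {n : ℕ} {a : ℝ} (ha : a ∈ lateSet n) (m : ℕ) :
    foldOrbit n a m ∈ lateSet (n + m) := by
  refine ⟨foldOrbit_nonneg ha.1 m, fun l k h => ?_⟩
  rw [← foldOrbit_add, add_assoc]
  exact ha.2 (m + l) k (by omega)

theorem lateSet_inter_eq_empty {k n : ℕ} (h : n + 1 ≤ regularTime k) :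
    lateSet n ∩ Set.Iic (tailSum k n) = ∅ := by
  refine Set.eq_empty_of_forall_notMem fun a ha => ?_
  exact absurd ha.2 (not_le.2 (ha.1.2 0 k h))

/-- One Thue–Morse block translates an error of order `k + 1` to an error of order `k + 1`, unless the
error is of order `k + 2` just before this block or is reflected to one of order `k + 2` by it. -/
theorem volume_lateSet_le (k n : ℕ) :
    volume (lateSet n ∩ Set.Iic (tailSum k n)) ≤
      volume (lateSet (n + 2 ^ (k + 1)) ∩ Set.Iic (tailSum k (n + 2 ^ (k + 1)))) +
      (volume (lateSet n ∩ Set.Iic (tailSum (k + 1) n)) +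
        volume (lateSet (n + 2 ^ (k + 1)) ∩ Set.Iic (tailSum (k + 1) (n + 2 ^ (k + 1))))) := by
  by_cases hn : n + 1 ≤ regularTime k
  · simp [lateSet_inter_eq_empty hn]
  set D := 2 ^ (k + 1) with hD
  set f := tmDiff (k + 1) n with hf
  have hsub : lateSet n ∩ Set.Iic (tailSum k n) ⊆
      ((fun a => a + -f) ⁻¹' (lateSet (n + D) ∩ Set.Iic (tailSum k (n + D)))) ∪
      ((lateSet n ∩ Set.Iic (tailSum (k + 1) n)) ∪
      ((fun a => a + -f) ⁻¹' (-(lateSet (n + D) ∩ Set.Iic (tailSum (k + 1) (n + D)))))) := by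
    rintro a ⟨ha, hak⟩
    have hak' : a ≤ tailSum k n := hak
    have h1 := foldOrbit_block ha.1 (hak'.trans (tailSum_le k n)) fun j hj =>
      (regularTime_strictMono hj).le.trans (not_le.1 hn).le
    have h2 := foldOrbit_mem_lateSet ha D
    rw [h1] at h2
    rcases le_or_gt f a with h | h
    · left
      rw [abs_of_nonneg (sub_nonneg.2 h)] at h2
      refine ⟨by simpa [sub_eq_add_neg] using h2, ?_⟩
      have := tailSum_eq k n
      simp only [Set.mem_Iic]
      linarith
    · right
      rw [abs_of_neg (sub_neg.2 h), neg_sub] at h2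
      rcases le_or_gt a (tailSum (k + 1) n) with h' | h'
      · exact Or.inl ⟨ha, h'⟩
      · refine Or.inr ⟨by simpa [sub_eq_add_neg] using h2, ?_⟩
        have := tailSum_add (k + 1) n
        simp only [Set.mem_Iic, neg_add, neg_neg]
        linarith
  refine (measure_mono hsub).trans ((measure_union_le _ _).trans ?_)
  rw [measure_preimage_add_right]
  gcongr
  refine (measure_union_le _ _).trans ?_
  rw [measure_preimage_add_right, Measure.measure_neg]

theorem volume_lateSet_le_tailSum (k n : ℕ) :
    volume (lateSet n ∩ Set.Iic (tailSum k n)) ≤ ENNReal.ofReal (tailSum k n) := by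
  have h : lateSet n ∩ Set.Iic (tailSum k n) ⊆ Set.Icc 0 (tailSum k n) := fun a ha => ⟨ha.1.1, ha.2⟩
  simpa using measure_mono (μ := volume) h

theorem volume_lateSet_le_iterate {k n J : ℕ} {ε : ℝ} (hε : 0 ≤ ε)
    (h : ∀ i ≤ J, volume (lateSet (n + i * 2 ^ (k + 1)) ∩
        Set.Iic (tailSum (k + 1) (n + i * 2 ^ (k + 1)))) ≤
      ENNReal.ofReal (ε * tailSum (k + 1) (n + i * 2 ^ (k + 1)))) :
    volume (lateSet n ∩ Set.Iic (tailSum k n)) ≤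
      ENNReal.ofReal (ε * (tailSum k n - tailSum k (n + J * 2 ^ (k + 1))) +
        tailSum k (n + J * 2 ^ (k + 1))) := by
  have key : volume (lateSet n ∩ Set.Iic (tailSum k n)) ≤
      ENNReal.ofReal (ε * (tailSum k n - tailSum k (n + J * 2 ^ (k + 1)))) +
      volume (lateSet (n + J * 2 ^ (k + 1)) ∩ Set.Iic (tailSum k (n + J * 2 ^ (k + 1)))) := by
    induction J with
    | zero => simp
    | succ J ih =>
      refine (ih fun i hi => h i (by omega)).trans ?_
      have h0 := h J (by omega)
      have h1 := h (J + 1) le_rfl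
      rw [show n + (J + 1) * 2 ^ (k + 1) = n + J * 2 ^ (k + 1) + 2 ^ (k + 1) by ring] at h1 ⊢
      set n' := n + J * 2 ^ (k + 1) with hn'
      have h2 := tailSum_add (k + 1) n'
      have h3 := tailSum_eq k n'
      have h4 := tailSum_antitone k (Nat.le_add_right n (J * 2 ^ (k + 1)))
      have h5 := tailSum_pos (k + 1) n'
      have h6 := tailSum_pos (k + 1) (n' + 2 ^ (k + 1))
      have h7 := add_le_add h0 h1
      rw [← ENNReal.ofReal_add (by positivity) (by positivity), ← mul_add, h2] at h7
      calc _ ≤ ENNReal.ofReal (ε * (tailSum k n - tailSum k n')) + (_ + _) :=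
            add_le_add le_rfl ((volume_lateSet_le k n').trans (add_le_add le_rfl h7))
        _ = _ := by
          rw [add_comm (volume _), ← add_assoc, ← ENNReal.ofReal_add
            (mul_nonneg hε (sub_nonneg.2 h4)) (mul_nonneg hε (tmDiff_pos _ _).le)]
          congr 2
          rw [h3]
          ring
  have h4 := tailSum_antitone k (Nat.le_add_right n (J * 2 ^ (k + 1)))
  rw [ENNReal.ofReal_add (mul_nonneg hε (sub_nonneg.2 h4)) (tailSum_pos _ _).le]
  exact key.trans (add_le_add le_rfl (volume_lateSet_le_tailSum _ _))

/-- In the regular regime, the tail sums of order `k + 1` decay like the power `-(k + 1)`. -/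
theorem tailSum_le_mul {k n : ℕ} (hn : regularTime k ≤ n + 1) (y : ℕ) :
    tailSum k y ≤ 4 * (((n : ℝ) + 1) / (y + 1)) ^ (k + 1) * tailSum k n := by
  have h1 := (tailSum_le k y).trans (tmDiff_le k y)
  have h2 := (le_tmDiff k n).trans
    ((div_le_iff₀ two_pos).1 (half_tmDiff_le_tailSum k n))
  have h3 : ((k : ℝ) + 1) * 2 ^ (k + 2) ≤ n + 1 := by exact_mod_cast hn
  have h4 : (n : ℝ) + 2 ^ k + k ≤ (n + 1) * (1 + 1 / (2 * (k + 1))) := by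
    have h5 : (k : ℝ) ≤ 2 ^ k := by exact_mod_cast Nat.lt_two_pow_self.le
    have h6 : (2 : ℝ) ^ k + k ≤ (n + 1) / (2 * (k + 1)) := by
      rw [le_div_iff₀ (by positivity)]
      rw [pow_add] at h3
      have : ((k : ℝ) + 1) * k ≤ (k + 1) * 2 ^ k := by gcongr
      linarith
    have : ((n : ℝ) + 1) * (1 + 1 / (2 * (k + 1))) = n + 1 + (n + 1) / (2 * (k + 1)) := by ring
    linarith
  have h5 : (1 + 1 / (2 * ((k : ℝ) + 1))) ^ (k + 1) ≤ 2 := by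
    have h6 : (1 + 1 / (2 * ((k : ℝ) + 1))) ^ (k + 1) ≤ Real.exp (1 / (2 * (k + 1))) ^ (k + 1) := by
      gcongr
      rw [add_comm]
      exact Real.add_one_le_exp _
    rw [← Real.exp_nat_mul, show ((k + 1 : ℕ) : ℝ) * (1 / (2 * (k + 1))) = 1 / 2 by
      push_cast; field_simp] at h6
    have h7 : Real.exp (1 / 2) * Real.exp (1 / 2) = Real.exp 1 := by rw [← Real.exp_add]; norm_num
    have h8 := Real.exp_one_lt_d9
    nlinarith [Real.exp_pos (1 / 2)]
  have h6 : ((n : ℝ) + 2 ^ k + k) ^ (k + 1) ≤ (n + 1) ^ (k + 1) * 2 :=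
    calc _ ≤ (((n : ℝ) + 1) * (1 + 1 / (2 * (k + 1)))) ^ (k + 1) := by gcongr
      _ ≤ _ := by rw [mul_pow]; gcongr
  set C : ℝ := 2 ^ k.choose 2 * k ! with hC
  have hC0 : 0 < C := by positivity
  have h7 : C / ((n + 1) ^ (k + 1) * 2) ≤ tailSum k n * 2 := le_trans (by gcongr) h2
  rw [div_le_iff₀ (by positivity)] at h7
  calc tailSum k y ≤ C / ((y : ℝ) + 1) ^ (k + 1) := h1
    _ ≤ tailSum k n * 2 * ((n + 1) ^ (k + 1) * 2) / ((y : ℝ) + 1) ^ (k + 1) := by gcongr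
    _ = _ := by rw [div_pow]; ring

/-- The times `Y * (3 / 2) ^ k` serve as deadlines for reaching order `k + 1`. Missing the next
deadline has conditional probability at most `4 * (4 / 5) ^ (k + 1)`, and as `3 / 2 < 2` the
deadlines fall below `regularTime K` for some `K`. -/
theorem volume_lateSet_le_of_deadline {K : ℕ} {Y : ℝ} (hY : Y * (3 / 2) ^ K ≤ regularTime K)
    (d : ℕ) {k n : ℕ} (hk : 1 ≤ k) (hd : k + d = K) (hn : (n : ℝ) + 1 ≤ Y * (3 / 2) ^ k) :
    volume (lateSet n ∩ Set.Iic (tailSum k n)) ≤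
      ENNReal.ofReal (20 * (4 / 5) ^ (k + 1) * tailSum k n) := by
  induction d generalizing k n with
  | zero =>
    obtain rfl : k = K := by omega
    rw [lateSet_inter_eq_empty (by exact_mod_cast hn.trans hY)]
    simp
  | succ d ih =>
    by_cases hreg : n + 1 ≤ regularTime k
    · simp [lateSet_inter_eq_empty hreg]
    replace hreg := (not_le.1 hreg).le
    set D := 2 ^ (k + 1) with hD
    have hD4 : (D : ℝ) ≤ (n + 1) / 4 := by
      have h1 : ((k : ℝ) + 1) * 2 ^ (k + 2) ≤ n + 1 := by exact_mod_cast hreg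
      have h2 : (1 : ℝ) ≤ k := by exact_mod_cast hk
      have h3 : (2 : ℝ) * 2 ^ (k + 2) ≤ (k + 1) * 2 ^ (k + 2) := by gcongr; linarith
      rw [hD, le_div_iff₀ (by norm_num)]
      push_cast
      rw [pow_succ (2 : ℝ) (k + 1)] at h1 h3
      linarith
    have hD0 : (0 : ℝ) < D := by positivity
    set Z := Y * (3 / 2) ^ (k + 1) with hZ
    have hZn : 3 / 2 * ((n : ℝ) + 1) ≤ Z := by rw [hZ, pow_succ]; linarith
    set J := ⌊(Z - (n + 1)) / D⌋₊ with hJ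
    have hJ1 : (J : ℝ) * D ≤ Z - (n + 1) := by
      rw [← le_div_iff₀ hD0]
      exact Nat.floor_le (div_nonneg (by linarith [(Nat.cast_nonneg n : (0 : ℝ) ≤ n)]) hD0.le)
    have hJ2 : Z - (n + 1) < (J + 1) * D := by
      rw [← div_lt_iff₀ hD0]
      exact Nat.lt_floor_add_one _
    have h1 := volume_lateSet_le_iterate (k := k) (n := n) (J := J)
      (ε := 20 * (4 / 5) ^ (k + 1 + 1)) (by positivity) fun i hi =>
        ih (by omega) (by omega) (by
          have : (i : ℝ) * D ≤ J * D := by gcongr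
          push_cast [← hD]
          linarith)
    refine h1.trans (ENNReal.ofReal_le_ofReal ?_)
    rw [← hD]
    set y := n + J * D with hy
    have h2 := tailSum_le_mul hreg y
    have h3 : ((n : ℝ) + 1) / (y + 1) ≤ 4 / 5 := by
      rw [div_le_div_iff₀ (by positivity) (by norm_num), hy]
      push_cast
      linarith
    have h4 : 4 * (((n : ℝ) + 1) / (y + 1)) ^ (k + 1) * tailSum k n ≤
        4 * (4 / 5) ^ (k + 1) * tailSum k n := by
      have := tailSum_pos k n
      gcongr
    have h5 : (0 : ℝ) ≤ (4 / 5) ^ (k + 1 + 1) * tailSum k y := by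
      have := tailSum_pos k y
      positivity
    rw [pow_succ _ (k + 1)] at h5 ⊢
    linarith

theorem exists_deadline (Y : ℝ) (k : ℕ) : ∃ K, k ≤ K ∧ Y * (3 / 2) ^ K ≤ regularTime K := by
  obtain ⟨N, hN⟩ := pow_unbounded_of_one_lt Y (show (1 : ℝ) < 4 / 3 by norm_num)
  refine ⟨N + k, by omega, ?_⟩
  have h1 : (4 / 3 : ℝ) ^ N ≤ (4 / 3) ^ (N + k) := by gcongr <;> [norm_num; omega]
  calc Y * (3 / 2) ^ (N + k) ≤ (4 / 3) ^ (N + k) * (3 / 2) ^ (N + k) := by gcongr; linarith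
    _ = 2 ^ (N + k) := by rw [← mul_pow]; norm_num
    _ ≤ (N + k + 1) * 2 ^ (N + k + 2) := by
      rw [pow_add _ (N + k) 2]
      nlinarith [pow_pos (two_pos (α := ℝ)) (N + k), (Nat.cast_nonneg (N + k) : (0 : ℝ) ≤ _),
        (Nat.cast_nonneg N : (0 : ℝ) ≤ N), (Nat.cast_nonneg k : (0 : ℝ) ≤ k),
        mul_nonneg (add_nonneg (Nat.cast_nonneg N : (0 : ℝ) ≤ N) (Nat.cast_nonneg k : (0 : ℝ) ≤ k))
          (pow_pos (two_pos (α := ℝ)) (N + k)).le]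
    _ = _ := by rw [regularTime]; push_cast; ring

theorem volume_lateSet_le_geometric {k : ℕ} (hk : 1 ≤ k) (n : ℕ) :
    volume (lateSet n ∩ Set.Iic (tailSum k n)) ≤
      ENNReal.ofReal (20 * (4 / 5) ^ (k + 1) * tailSum k n) := by
  obtain ⟨K, hkK, hK⟩ := exists_deadline ((n : ℝ) + 1) k
  refine volume_lateSet_le_of_deadline hK (K - k) hk (by omega) ?_
  exact le_mul_of_one_le_right (by positivity) (one_le_pow₀ (by norm_num))

/-- The bound for the proportion of `lateSet` passes from order `k + d + 1` down to order `k + 1`, as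
almost every error of order `k + 1` is of order `k + d + 1` at some later time. -/
theorem volume_lateSet_le_of_le {k : ℕ} {ε : ℝ} (hε : 0 ≤ ε) (d : ℕ)
    (h : ∀ n, volume (lateSet n ∩ Set.Iic (tailSum (k + d) n)) ≤
      ENNReal.ofReal (ε * tailSum (k + d) n)) (n : ℕ) :
    volume (lateSet n ∩ Set.Iic (tailSum k n)) ≤ ENNReal.ofReal (ε * tailSum k n) := by
  induction d generalizing n with
  | zero => exact h n
  | succ d ih =>
    refine ih (fun n => ?_) n
    have h1 : ∀ J : ℕ, _ := fun J =>
      volume_lateSet_le_iterate (k := k + d) (n := n) (J := J) hε fun i _ => h _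
    have h3 : Tendsto (fun N : ℕ => n + N * 2 ^ (k + d + 1)) atTop atTop :=
      tendsto_atTop_mono (fun N => (Nat.le_mul_of_pos_right N (by positivity)).trans
        (Nat.le_add_left _ n)) tendsto_id
    have h4 : Tendsto (tailSum (k + d)) atTop (nhds 0) :=
      squeeze_zero (fun n => (tailSum_pos _ n).le) (tailSum_le _) (tendsto_tmDiff _)
    have h5 := h4.comp h3
    have h6 := ((h5.const_sub (tailSum (k + d) n)).const_mul ε).add h5
    rw [sub_zero, add_zero] at h6
    exact ge_of_tendsto' ((ENNReal.continuous_ofReal.tendsto _).comp h6) h1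

theorem volume_lateSet_eq_zero (n : ℕ) :
    volume (lateSet n ∩ Set.Iic (tailSum 0 n)) = 0 := by
  have h1 : ∀ k : ℕ, volume (lateSet n ∩ Set.Iic (tailSum 0 n)) ≤
      ENNReal.ofReal (20 * (4 / 5) ^ (k + 1 + 1) * tailSum 0 n) := fun k =>
    volume_lateSet_le_of_le (by positivity) (k + 1) (fun n => by
      rw [zero_add]; exact volume_lateSet_le_geometric (by omega) n) n
  have h2 : Tendsto (fun k : ℕ => 20 * (4 / 5 : ℝ) ^ (k + 1 + 1) * tailSum 0 n) atTop (nhds 0) := by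
    have := (tendsto_add_atTop_iff_nat 2).2
      (tendsto_pow_atTop_nhds_zero_of_lt_one (show (0 : ℝ) ≤ 4 / 5 by norm_num) (by norm_num))
    simpa using (this.const_mul 20).mul_const (tailSum 0 n)
  have h3 := (ENNReal.continuous_ofReal.tendsto _).comp h2
  rw [ENNReal.ofReal_zero] at h3
  exact le_antisymm (ge_of_tendsto' h3 h1) zero_le

theorem volume_foldOrbit_preimage {s : Set ℝ} (hs : volume s = 0) (n : ℕ) :
    volume {τ : ℝ | foldOrbit 0 |τ| n ∈ s} = 0 := by
  have habs : ∀ {s : Set ℝ}, volume s = 0 → volume {x : ℝ | |x| ∈ s} = 0 := fun {s} hs => by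
    have h : {x : ℝ | |x| ∈ s} ⊆ s ∪ -s := fun x hx => by
      rcases abs_choice x with h | h <;> rw [Set.mem_ofPred_eq, h] at hx
      · exact Or.inl hx
      · exact Or.inr hx
    refine measure_mono_null h (measure_union_null hs ?_)
    rwa [Measure.measure_neg]
  induction n generalizing s with
  | zero => exact habs hs
  | succ n ih =>
    refine ih (s := {x | |x - tmDiff 0 (0 + n)| ∈ s}) ?_
    have := habs hs
    rw [← measure_preimage_add_right volume (-tmDiff 0 (0 + n))] at this
    simpa [sub_eq_add_neg] using this

/-- As the harmonic series diverges, every orbit attains order one at arbitrarily late times. -/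
theorem exists_foldOrbit_le_tailSum {a : ℝ} (ha : 0 ≤ a) (N : ℕ) :
    ∃ n ≥ N, foldOrbit 0 a n ≤ tailSum 0 n := by
  obtain ⟨n, hn, h⟩ : ∃ n ≥ N, foldOrbit 0 a n ≤ tmDiff 0 n := by
    by_contra! hcon
    have h1 : ∀ m, foldOrbit 0 a (N + m) =
        foldOrbit 0 a N - ∑ i ∈ Finset.range m, 1 / (((i + (N + 1) : ℕ) : ℝ)) := by
      intro m
      induction m with
      | zero => simp
      | succ m ih =>
        have := hcon (N + m) (by omega)
        rw [← add_assoc, foldOrbit, zero_add, abs_of_pos (sub_pos.2 this), ih,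
          Finset.sum_range_succ, tmDiff]
        push_cast
        ring
    have h2 : ¬ Summable fun i : ℕ => 1 / (((i + (N + 1) : ℕ) : ℝ)) := fun h =>
      Real.not_summable_one_div_natCast ((summable_nat_add_iff (N + 1)).1 h)
    refine h2 (summable_of_sum_range_le (c := foldOrbit 0 a N) (fun i => by positivity) fun m => ?_)
    have := h1 m
    have := foldOrbit_nonneg (n := 0) ha (N + m)
    linarith
  by_cases h' : foldOrbit 0 a n ≤ tailSum 0 n
  · exact ⟨n, hn, h'⟩
  · refine ⟨n + 1, by omega, ?_⟩
    have h1 := tailSum_add 0 n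
    rw [foldOrbit, zero_add, abs_of_nonpos (sub_nonpos.2 h)]
    rw [pow_zero] at h1
    linarith [not_le.1 h']

/-- For almost every target, the error attains infinitely often an order `k + 1` by the time
`regularTime k`. -/
theorem ae_frequently_le_tailSum :
    ∀ᵐ τ : ℝ ∂volume, ∀ N, ∃ m ≥ N, ∃ k, m + 1 ≤ regularTime k ∧
      foldOrbit 0 |τ| m ≤ tailSum k m := by
  have h : ∀ᵐ τ : ℝ ∂volume, ∀ n, foldOrbit 0 |τ| n ∉ lateSet n ∩ Set.Iic (tailSum 0 n) :=
    ae_all_iff.2 fun n => by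
      rw [ae_iff]
      simpa using volume_foldOrbit_preimage (volume_lateSet_eq_zero n) n
  filter_upwards [h] with τ hτ N
  obtain ⟨n, hn, h1⟩ := exists_foldOrbit_le_tailSum (abs_nonneg τ) N
  have h2 : foldOrbit 0 |τ| n ∉ lateSet n := fun h => hτ n ⟨h, h1⟩
  simp only [lateSet, Set.mem_ofPred_eq, not_and, not_forall, not_lt] at h2
  obtain ⟨m, k, h3, h4⟩ := h2 (foldOrbit_nonneg (abs_nonneg τ) n)
  refine ⟨n + m, by omega, k, h3, ?_⟩
  rwa [foldOrbit_add, zero_add]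

/-! ### Counting the pieces of the error as a function of the target -/

/-- On `J`, the function `g` is affine of slope `1` or `-1`. -/
def IsFoldPiece (g : ℝ → ℝ) (J : Set ℝ) : Prop :=
  ∃ ε c : ℝ, (ε = 1 ∨ ε = -1) ∧ ∀ τ ∈ J, g τ = ε * τ + c

theorem IsFoldPiece.mono {g : ℝ → ℝ} {J J' : Set ℝ} (h : IsFoldPiece g J) (hJ : J' ⊆ J) :
    IsFoldPiece g J' := by
  obtain ⟨ε, c, hε, h⟩ := h
  exact ⟨ε, c, hε, fun τ hτ => h τ (hJ hτ)⟩

theorem IsFoldPiece.abs_sub {g : ℝ → ℝ} {J : Set ℝ} (h : IsFoldPiece g J) (hJ : J.OrdConnected)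
    {d : ℝ} (hd : ∀ τ ∈ J, |g τ - d| ≠ 0) : IsFoldPiece (fun τ => |g τ - d|) J := by
  obtain ⟨ε, c, hε, h⟩ := h
  -- the zero of the affine function is not in `J`, which therefore lies on one side of it
  have hz : ε * (d - c) ∉ J := fun hmem => hd _ hmem <| by
    rw [h _ hmem]
    rcases hε with rfl | rfl <;> simp
  have hside : (∀ τ ∈ J, ε * (d - c) < τ) ∨ ∀ τ ∈ J, τ < ε * (d - c) := by
    by_contra! hcon
    obtain ⟨⟨x, hx, hx'⟩, y, hy, hy'⟩ := hcon
    exact hz (hJ.out hx hy ⟨hx', hy'⟩)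
  rcases hε with rfl | rfl <;> rcases hside with hs | hs
  · exact ⟨1, c - d, Or.inl rfl, fun τ hτ => by
      have := hs τ hτ
      dsimp only
      rw [h τ hτ, abs_of_pos (by linarith)]; ring⟩
  · exact ⟨-1, d - c, Or.inr rfl, fun τ hτ => by
      have := hs τ hτ
      dsimp only
      rw [h τ hτ, abs_of_neg (by linarith)]; ring⟩
  · exact ⟨1, d - c, Or.inl rfl, fun τ hτ => by
      have := hs τ hτ
      dsimp only
      rw [h τ hτ, abs_of_neg (by linarith)]; ring⟩
  · exact ⟨-1, c - d, Or.inr rfl, fun τ hτ => by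
      have := hs τ hτ
      dsimp only
      rw [h τ hτ, abs_of_pos (by linarith)]; ring⟩

theorem IsFoldPiece.foldOrbit_succ {n : ℕ} {J : Set ℝ}
    (h : IsFoldPiece (fun τ => foldOrbit 0 |τ| n) J) (hJ : J.OrdConnected)
    (h0 : ∀ τ ∈ J, foldOrbit 0 |τ| (n + 1) ≠ 0) :
    IsFoldPiece (fun τ => foldOrbit 0 |τ| (n + 1)) J :=
  h.abs_sub hJ h0

theorem IsFoldPiece.foldOrbit_add {n W : ℕ} {J : Set ℝ}
    (h : IsFoldPiece (fun τ => foldOrbit 0 |τ| n) J) (hJ : J.OrdConnected)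
    (h0 : ∀ m < W, ∀ τ ∈ J, foldOrbit 0 |τ| (n + m + 1) ≠ 0) :
    IsFoldPiece (fun τ => foldOrbit 0 |τ| (n + W)) J := by
  induction W with
  | zero => exact h
  | succ W ih =>
    exact (ih fun m hm => h0 m (by omega)).foldOrbit_succ hJ (h0 W (by omega))

/-- A short interval on which the error at time `n` is affine is cut at most once within the next
`2 ^ (k + 1)` steps: after a cut the error of both pieces starts near `0`, and then follows a
Thue–Morse block, in the interior of which it does not come back to `0`. -/
theorem IsFoldPiece.exists_cut {k n W : ℕ} {L : ℝ} (hn : ∀ j < k, regularTime j ≤ n + 1)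
    (hW : W ≤ 2 ^ (k + 1)) (hL : L ≤ tmDiff k (n + W) / 2) {J : Set ℝ} (hJ : J.OrdConnected)
    (hJL : ∀ x ∈ J, ∀ y ∈ J, |x - y| ≤ L) (h : IsFoldPiece (fun τ => foldOrbit 0 |τ| n) J) :
    ∃ c : ℝ, ∀ J' ⊆ J, J'.OrdConnected → c ∉ J' →
      IsFoldPiece (fun τ => foldOrbit 0 |τ| (n + W)) J' := by
  classical
  by_cases hex : ∃ m, m < W ∧ ∃ τ ∈ J, foldOrbit 0 |τ| (n + m + 1) = 0
  swap
  · push Not at hex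
    exact ⟨0, fun J' hJ' _ _ => (h.foldOrbit_add hJ hex).mono hJ'⟩
  obtain ⟨hm, τ₀, hτ₀, h0⟩ := Nat.find_spec hex
  set m := Nat.find hex with hm_def
  have h1 : IsFoldPiece (fun τ => foldOrbit 0 |τ| (n + m)) J :=
    h.foldOrbit_add hJ fun l hl τ hτ h' => Nat.find_min hex hl ⟨hl.trans hm, τ, hτ, h'⟩
  have h2 : ∀ τ ∈ J, foldOrbit 0 |τ| (n + m + 1) = |τ - τ₀| := by
    obtain ⟨ε, c, hε, h3⟩ := h1
    dsimp only at h3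
    intro τ hτ
    rw [foldOrbit] at h0 ⊢
    rw [abs_eq_zero, h3 τ₀ hτ₀, sub_eq_zero] at h0
    rw [h3 τ hτ, ← h0]
    rcases hε with rfl | rfl
    · congr 1; ring
    · rw [← abs_neg]; congr 1; ring
  refine ⟨τ₀, fun J' hJ' hJ'c hτ₀' => ?_⟩
  have h3 : IsFoldPiece (fun τ => foldOrbit 0 |τ| (n + m + 1)) J' :=
    (h1.mono hJ').foldOrbit_succ hJ'c fun τ hτ => by
      rw [h2 τ (hJ' hτ), abs_ne_zero, sub_ne_zero]
      rintro rfl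
      exact hτ₀' hτ
  obtain ⟨l, hl⟩ := Nat.exists_eq_add_of_lt hm
  rw [show n + W = n + m + 1 + l by omega]
  refine h3.foldOrbit_add hJ'c fun i hi τ hτ => ?_
  rw [add_assoc (n + m + 1), _root_.foldOrbit_add, zero_add, h2 τ (hJ' hτ)]
  refine (foldOrbit_pos_of_lt (k := k) (abs_nonneg _) ?_ (fun j hj => (hn j hj).trans (by omega))
    (by omega) (by omega)).ne'
  have := tmDiff_antitone k (show n + m + 1 ≤ n + W by omega)
  have := hJL τ (hJ' hτ) τ₀ hτ₀
  linarith

/-- The points of the finite set `Z`, one of which is the left end `-A`, cut `[-A, A]` into intervals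
on which the error at time `n` is an affine function of slope `±1` of the target. -/
def HasCuts (A : ℝ) (n : ℕ) (Z : Finset ℝ) : Prop :=
  -A ∈ Z ∧ ∀ J : Set ℝ, J.OrdConnected → J ⊆ Set.Icc (-A) A → (∀ z ∈ Z, z ∉ J) →
    IsFoldPiece (fun τ => foldOrbit 0 |τ| n) J

/-- The component of `[-A, A] \ Z` to the right of the point `z` of `Z`. -/
def cutComponent (A : ℝ) (Z : Finset ℝ) (z : ℝ) : Set ℝ :=
  {τ | τ ∈ Set.Icc (-A) A ∧ z < τ ∧ ∀ z' ∈ Z, z < z' → τ < z'}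

theorem ordConnected_cutComponent (A : ℝ) (Z : Finset ℝ) (z : ℝ) :
    (cutComponent A Z z).OrdConnected :=
  ⟨fun _ hx _ hy _ ht => ⟨⟨hx.1.1.trans ht.1, ht.2.trans hy.1.2⟩, hx.2.1.trans_le ht.1,
    fun z' hz' h => ht.2.trans_lt (hy.2.2 z' hz' h)⟩⟩

theorem notMem_cutComponent {A : ℝ} {Z : Finset ℝ} {z z' : ℝ} (hz' : z' ∈ Z) :
    z' ∉ cutComponent A Z z := fun h => lt_irrefl _ (h.2.2 z' hz' h.2.1)

theorem exists_subset_cutComponent {A : ℝ} {Z : Finset ℝ} (hA : -A ∈ Z) {J : Set ℝ}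
    (hJ : J.OrdConnected) (hJA : J ⊆ Set.Icc (-A) A) (hJZ : ∀ z ∈ Z, z ∉ J) :
    ∃ z ∈ Z, J ⊆ cutComponent A Z z := by
  classical
  rcases J.eq_empty_or_nonempty with rfl | ⟨x, hx⟩
  · exact ⟨-A, hA, Set.empty_subset _⟩
  have hne : (Z.filter (· ≤ x)).Nonempty := ⟨-A, by simp [hA, (hJA hx).1]⟩
  obtain ⟨z, hz, hmax⟩ := (Z.filter (· ≤ x)).exists_max_image id hne
  rw [Finset.mem_filter] at hz
  refine ⟨z, hz.1, fun τ hτ => ⟨hJA hτ, ?_, fun z' hz' hlt => ?_⟩⟩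
  · by_contra! hle
    exact hJZ z hz.1 (hJ.out hτ hx ⟨hle, hz.2⟩)
  · by_contra! hle
    refine hJZ z' hz' (hJ.out hx hτ ⟨?_, hle⟩)
    by_contra! hlt'
    exact absurd (hmax z' (Finset.mem_filter.2 ⟨hz', hlt'.le⟩)) (not_le.2 hlt)

theorem exists_grid {A L : ℝ} (hA : 0 ≤ A) (hL : 0 < L) :
    ∃ Z : Finset ℝ, (Z.card : ℝ) ≤ 2 * A / L + 1 ∧ ∀ J : Set ℝ, J.OrdConnected →
      J ⊆ Set.Icc (-A) A → (∀ z ∈ Z, z ∉ J) → ∀ x ∈ J, ∀ y ∈ J, |x - y| ≤ L := by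
  classical
  refine ⟨(Finset.range (⌊2 * A / L⌋₊ + 1)).image fun i : ℕ => -A + i * L, ?_, ?_⟩
  · refine (Nat.cast_le.2 Finset.card_image_le).trans ?_
    rw [Finset.card_range]
    push_cast
    have := Nat.floor_le (show 0 ≤ 2 * A / L by positivity)
    linarith
  · intro J hJ hJA hJZ
    have key : ∀ x ∈ J, ∀ y ∈ J, y - x ≤ L := by
      intro x hx y hy
      by_contra! hlt
      have h0 : 0 ≤ (x + A) / L := div_nonneg (by linarith [(hJA hx).1]) hL.le
      have h1 := Nat.le_ceil ((x + A) / L)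
      have h2 := Nat.ceil_lt_add_one h0
      set i := ⌈(x + A) / L⌉₊
      rw [div_le_iff₀ hL] at h1
      rw [← sub_lt_iff_lt_add, lt_div_iff₀ hL] at h2
      refine hJZ (-A + i * L) (Finset.mem_image.2 ⟨i, ?_, rfl⟩)
        (hJ.out hx hy ⟨by linarith, by linarith⟩)
      rw [Finset.mem_range, Nat.lt_succ_iff]
      refine Nat.le_floor ?_
      rw [le_div_iff₀ hL]
      linarith [(hJA hy).2]
    intro x hx y hy
    exact abs_sub_le_iff.2 ⟨key y hy x hx, key x hx y hy⟩

theorem HasCuts.exists_window {A L : ℝ} {k n W : ℕ} {Z : Finset ℝ} (hZ : HasCuts A n Z)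
    (hA : 0 ≤ A) (hn : ∀ j < k, regularTime j ≤ n + 1) (hW : W ≤ 2 ^ (k + 1)) (hL0 : 0 < L)
    (hL : L ≤ tmDiff k (n + W) / 2) :
    ∃ Z' : Finset ℝ, HasCuts A (n + W) Z' ∧ (Z'.card : ℝ) ≤ 2 * Z.card + 2 * (2 * A / L + 1) := by
  classical
  obtain ⟨G, hG, hGL⟩ := exists_grid hA hL0
  set Z₁ := Z ∪ G with hZ₁
  have hcut : ∀ z : ℝ, ∃ c : ℝ, ∀ J' ⊆ cutComponent A Z₁ z, J'.OrdConnected → c ∉ J' →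
      IsFoldPiece (fun τ => foldOrbit 0 |τ| (n + W)) J' := fun z => by
    have hsub : cutComponent A Z₁ z ⊆ Set.Icc (-A) A := fun τ hτ => hτ.1
    have hord := ordConnected_cutComponent A Z₁ z
    exact IsFoldPiece.exists_cut hn hW hL hord
      (hGL _ hord hsub fun z' hz' => notMem_cutComponent (Finset.mem_union_right _ hz'))
      (hZ.2 _ hord hsub fun z' hz' => notMem_cutComponent (Finset.mem_union_left _ hz'))
  choose c hc using hcut
  refine ⟨Z₁ ∪ Z₁.image c, ⟨?_, fun J hJ hJA hJZ => ?_⟩, ?_⟩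
  · exact Finset.mem_union_left _ (Finset.mem_union_left _ hZ.1)
  · obtain ⟨z, hz, hJz⟩ := exists_subset_cutComponent (Finset.mem_union_left _ hZ.1) hJ hJA
      fun z hz => hJZ z (Finset.mem_union_left _ hz)
    exact hc z J hJz hJ (hJZ _ (Finset.mem_union_right _ (Finset.mem_image_of_mem _ hz)))
  · have h1 : (Z₁ ∪ Z₁.image c).card ≤ 2 * Z₁.card := by
      have := Finset.card_union_le Z₁ (Z₁.image c)
      have := Finset.card_image_le (s := Z₁) (f := c)
      omega
    have h2 := Finset.card_union_le Z G
    have h3 : ((Z₁ ∪ Z₁.image c).card : ℝ) ≤ 2 * (Z.card + G.card) := by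
      exact_mod_cast h1.trans (Nat.mul_le_mul_left 2 h2)
    linarith

theorem HasCuts.exists_windows {A : ℝ} {k n T : ℕ} {Z : Finset ℝ} (hZ : HasCuts A n Z)
    (hA : 0 ≤ A) (hn : ∀ j < k, regularTime j ≤ n + 1) (i : ℕ) {n' : ℕ} (hnn' : n ≤ n')
    (hT : n' ≤ T) (hi : n' ≤ n + i * 2 ^ (k + 1)) :
    ∃ Z' : Finset ℝ, HasCuts A n' Z' ∧ (Z'.card : ℝ) + (8 * A + 2) / tmDiff k T ≤
      2 ^ i * (Z.card + (8 * A + 2) / tmDiff k T) := by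
  have hTp := tmDiff_pos k T
  induction i generalizing n' with
  | zero =>
    obtain rfl : n = n' := by omega
    exact ⟨Z, hZ, by simp⟩
  | succ i ih =>
    by_cases h : n' ≤ n + i * 2 ^ (k + 1)
    · obtain ⟨Z', h1, h2⟩ := ih hnn' hT h
      refine ⟨Z', h1, h2.trans ?_⟩
      gcongr
      · norm_num
      · omega
    · obtain ⟨Z', h1, h2⟩ := ih (n' := n + i * 2 ^ (k + 1)) (by omega) (by omega) le_rfl
      obtain ⟨W, rfl⟩ := Nat.exists_eq_add_of_le (not_le.1 h).le
      have hle := tmDiff_antitone k hT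
      obtain ⟨Z'', h3, h4⟩ := h1.exists_window (k := k) (W := W) (L := tmDiff k T / 2) hA
        (fun j hj => (hn j hj).trans (by omega))
        (by rw [add_mul] at hi; omega) (by positivity) (by linarith)
      refine ⟨Z'', h3, ?_⟩
      have h5 : tmDiff k T ≤ 1 := by
        have h6 : ∀ k, tmDiff k T ≤ tmDiff 0 T := fun k => by
          induction k with
          | zero => exact le_rfl
          | succ k ih => exact (tmDiff_succ_le k T).trans ih
        refine (h6 k).trans ?_
        rw [tmDiff]
        exact div_le_one_of_le₀ (by linarith [(Nat.cast_nonneg T : (0 : ℝ) ≤ T)]) (by positivity)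
      have h7 : 2 * (2 * A / (tmDiff k T / 2) + 1) ≤ (8 * A + 2) / tmDiff k T := by
        rw [le_div_iff₀ hTp]
        have : 2 * (2 * A / (tmDiff k T / 2) + 1) * tmDiff k T = 8 * A + 2 * tmDiff k T := by
          field_simp; ring
        linarith
      rw [pow_succ]
      linarith

theorem inv_tmDiff_regularTime_le (k : ℕ) :
    (tmDiff k (regularTime k))⁻¹ ≤ 2 ^ (k.choose 2 + 8 * k + 5) := by
  have h1 := le_tmDiff k (regularTime k)
  refine (inv_anti₀ (by positivity) h1).trans ?_
  rw [inv_div, div_le_iff₀ (by positivity)]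
  have h2 : ((regularTime k : ℕ) : ℝ) + 2 ^ k + k ≤ (k + 1) * 2 ^ (k + 3) := by
    have h : (k : ℝ) ≤ 2 ^ k := by exact_mod_cast Nat.lt_two_pow_self.le
    have h' : (0 : ℝ) ≤ k * 2 ^ k := by positivity
    simp only [regularTime, pow_add]
    push_cast
    linarith
  have h3 : ((k : ℝ) + 1) ^ (k + 1) ≤ 2 ^ (3 * k + 2) * k ! := by
    have h4 := Real.pow_div_factorial_le_exp ((k : ℝ) + 1) (by positivity) (k + 1)
    rw [div_le_iff₀ (by positivity)] at h4
    have h5 : Real.exp ((k : ℝ) + 1) ≤ 4 ^ (k + 1) := by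
      have h6 := Real.exp_nat_mul 1 (k + 1)
      push_cast at h6
      rw [mul_one] at h6
      rw [h6]
      gcongr
      linarith [Real.exp_one_lt_d9]
    have h7 : ((k + 1 : ℕ) : ℝ) ≤ 2 ^ k := by exact_mod_cast Nat.lt_two_pow_self
    calc ((k : ℝ) + 1) ^ (k + 1) ≤ Real.exp (k + 1) * (k + 1)! := h4
      _ ≤ 4 ^ (k + 1) * (2 ^ k * k !) := by
          rw [Nat.factorial_succ, Nat.cast_mul]
          gcongr
      _ = _ := by
          rw [show (4 : ℝ) = 2 ^ 2 by norm_num, ← pow_mul, ← mul_assoc, ← pow_add]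
          congr 2
          ring
  have h4 : 2 * k.choose 2 + k = k * k := by
    rw [Nat.choose_two_right, Nat.mul_div_cancel' (Nat.even_mul_pred_self k).two_dvd]
    cases k with
    | zero => rfl
    | succ k => rw [Nat.add_sub_cancel]; ring
  calc (((regularTime k : ℕ) : ℝ) + 2 ^ k + k) ^ (k + 1)
      ≤ ((k + 1) * 2 ^ (k + 3)) ^ (k + 1) := by gcongr
    _ = ((k : ℝ) + 1) ^ (k + 1) * 2 ^ ((k + 3) * (k + 1)) := by rw [mul_pow, ← pow_mul]
    _ ≤ 2 ^ (3 * k + 2) * k ! * 2 ^ ((k + 3) * (k + 1)) := by gcongr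
    _ = 2 ^ (k.choose 2 + 8 * k + 5 + k.choose 2) * k ! := by
      rw [show k.choose 2 + 8 * k + 5 + k.choose 2 = (k + 3) * (k + 1) + (3 * k + 2) by
        linarith, pow_add]
      ring
    _ = _ := by rw [pow_add _ _ (k.choose 2)]; ring

/-- Each window of length `2 ^ (k + 1)` doubles the number of pieces, up to an additive term controlled
by `inv_tmDiff_regularTime_le`, and the times from `k * 2 ^ (k + 1)` to `regularTime k` make up `k + 2`
such windows. The product of the factors `2 ^ (k + 2)` gives the leading exponent. -/
theorem exists_hasCuts {A : ℝ} (hA : 0 ≤ A) (k : ℕ) {n : ℕ} (hn : k * 2 ^ (k + 1) ≤ n)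
    (hn' : n ≤ regularTime k) :
    ∃ Z : Finset ℝ, HasCuts A n Z ∧
      (Z.card : ℝ) ≤ (8 * A + 2) * 2 ^ ((k + 1).choose 2 + 9 * (k + 1) + 5) := by
  obtain ⟨Z, hZ, hcard⟩ : ∃ Z : Finset ℝ, HasCuts A (k * 2 ^ (k + 1)) Z ∧
      (Z.card : ℝ) ≤ (8 * A + 2) * 2 ^ (k.choose 2 + 9 * k + 5) := by
    cases k with
    | zero =>
      refine ⟨{-A, 0}, ⟨by simp, fun J hJ hJA hJZ => ?_⟩, ?_⟩
      · have h0 : IsFoldPiece (fun τ => τ) J := ⟨1, 0, Or.inl rfl, fun τ _ => by ring⟩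
        have h1 := h0.abs_sub hJ (d := 0) fun τ hτ h => hJZ 0 (by simp) (by
          rw [sub_zero, abs_eq_zero] at h
          rwa [← h])
        simpa [foldOrbit] using h1
      · have h1 : ((({-A, 0} : Finset ℝ).card : ℕ) : ℝ) ≤ 2 := by
          exact_mod_cast Finset.card_le_two
        norm_num
        linarith
    | succ k => exact exists_hasCuts hA k (by gcongr <;> omega) le_rfl
  have hreg : ∀ j < k, regularTime j ≤ k * 2 ^ (k + 1) + 1 := by
    intro j hj
    obtain ⟨i, rfl⟩ := Nat.exists_eq_add_of_lt hj
    refine (regularTime_strictMono.monotone (Nat.le_add_right j i)).trans ?_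
    exact Nat.le_succ _
  obtain ⟨Z', hZ', hcard'⟩ := hZ.exists_windows (T := regularTime k) hA hreg (k + 2) hn hn' (by
    refine hn'.trans (le_of_eq ?_)
    simp only [regularTime]
    ring)
  refine ⟨Z', hZ', ?_⟩
  have h1 : (8 * A + 2) / tmDiff k (regularTime k) ≤
      (8 * A + 2) * 2 ^ (k.choose 2 + 9 * k + 5) := by
    rw [div_eq_mul_inv]
    gcongr
    refine (inv_tmDiff_regularTime_le k).trans ?_
    gcongr <;> norm_num
  have h2 : 0 ≤ (8 * A + 2) / tmDiff k (regularTime k) :=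
    div_nonneg (by linarith) (tmDiff_pos _ _).le
  calc (Z'.card : ℝ) ≤ 2 ^ (k + 2) * (Z.card + (8 * A + 2) / tmDiff k (regularTime k)) := by linarith
    _ ≤ 2 ^ (k + 2) * ((8 * A + 2) * 2 ^ (k.choose 2 + 9 * k + 5) +
        (8 * A + 2) * 2 ^ (k.choose 2 + 9 * k + 5)) := by gcongr
    _ = (8 * A + 2) * 2 ^ (k + k.choose 2 + 9 * k + 8) := by
      simp only [pow_add]
      ring
    _ ≤ _ := by
      rw [show (k + 1).choose 2 = k + k.choose 2 by
        rw [Nat.choose_succ_succ' k 1, Nat.choose_one_right]]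
      exact mul_le_mul_of_nonneg_left (pow_le_pow_right₀ one_le_two (by omega)) (by linarith)

theorem HasCuts.volume_le {A : ℝ} {n : ℕ} {Z : Finset ℝ} (hZ : HasCuts A n Z) (δ : ℝ) :
    volume {τ | τ ∈ Set.Icc (-A) A ∧ foldOrbit 0 |τ| n ≤ δ} ≤
      ENNReal.ofReal (Z.card * (2 * δ)) := by
  have hsub : {τ | τ ∈ Set.Icc (-A) A ∧ foldOrbit 0 |τ| n ≤ δ} ⊆
      (Z : Set ℝ) ∪ ⋃ z ∈ Z, {τ | τ ∈ cutComponent A Z z ∧ foldOrbit 0 |τ| n ≤ δ} := by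
    rintro τ ⟨hτ, hδ⟩
    by_cases hτZ : τ ∈ Z
    · exact Or.inl hτZ
    · obtain ⟨z, hz, hsub⟩ := exists_subset_cutComponent hZ.1 (J := {τ}) Set.ordConnected_singleton
        (by simpa using hτ) (fun z hz h => hτZ (by rwa [← Set.mem_singleton_iff.1 h]))
      exact Or.inr (Set.mem_biUnion hz ⟨hsub rfl, hδ⟩)
  have hpiece : ∀ z ∈ Z, volume {τ | τ ∈ cutComponent A Z z ∧ foldOrbit 0 |τ| n ≤ δ} ≤
      ENNReal.ofReal (2 * δ) := by
    intro z _
    obtain ⟨ε, c, hε, h⟩ := hZ.2 (cutComponent A Z z) (ordConnected_cutComponent A Z z)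
      (fun τ hτ => hτ.1) (fun z' hz' => notMem_cutComponent hz')
    rw [← Real.volume_closedBall (-(ε * c)) δ]
    refine measure_mono fun τ hτ => ?_
    have h1 := h τ hτ.1
    have h2 := foldOrbit_nonneg (n := 0) (abs_nonneg τ) n
    have h3 := hτ.2
    dsimp only at h1
    rw [h1] at h2 h3
    rw [Metric.mem_closedBall, Real.dist_eq, abs_le]
    rcases hε with rfl | rfl <;> constructor <;> linarith
  calc _ ≤ volume (Z : Set ℝ) +
        volume (⋃ z ∈ Z, {τ | τ ∈ cutComponent A Z z ∧ foldOrbit 0 |τ| n ≤ δ}) :=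
        (measure_mono hsub).trans (measure_union_le _ _)
    _ ≤ 0 + ∑ z ∈ Z, ENNReal.ofReal (2 * δ) := by
        refine add_le_add (le_of_eq (Z.measure_zero _)) ?_
        exact (measure_biUnion_finset_le _ _).trans (Finset.sum_le_sum hpiece)
    _ = _ := by
        rw [zero_add, Finset.sum_const, nsmul_eq_mul, ENNReal.ofReal_mul (Nat.cast_nonneg _),
          ENNReal.ofReal_natCast]

/-! ### Lower bound for almost every target -/

theorem exists_hasCuts_exp {A : ℝ} (hA : 0 ≤ A) (n : ℕ) :
    ∃ Z : Finset ℝ, HasCuts A n Z ∧ (Z.card : ℝ) ≤ (8 * A + 2) * Real.exp 10 *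
      Real.exp (Real.log (n + 1) ^ 2 / (2 * Real.log 2) + 10 * Real.log (n + 1)) := by
  classical
  have hex : ∃ k, n ≤ regularTime k :=
    ⟨n, (Nat.le_succ n).trans (Nat.le_mul_of_pos_right _ (by positivity))⟩
  obtain ⟨k, hk, hmin⟩ : ∃ k, n ≤ regularTime k ∧ ∀ j < k, ¬ n ≤ regularTime j :=
    ⟨Nat.find hex, Nat.find_spec hex, fun j hj => Nat.find_min hex hj⟩
  have hk' : k * 2 ^ (k + 1) ≤ n ∧ 2 ^ k ≤ n + 1 := by
    cases k with
    | zero => simp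
    | succ i =>
      have h1 : regularTime i < n := not_le.1 (hmin i (by omega))
      have h2 : (i + 1) * 2 ^ (i + 1 + 1) < n := h1
      have h3 : 1 * 2 ^ (i + 1) ≤ (i + 1) * 2 ^ (i + 1 + 1) := by gcongr <;> omega
      exact ⟨h2.le, by omega⟩
  obtain ⟨Z, hZ, hcard⟩ := exists_hasCuts hA k hk'.1 hk
  refine ⟨Z, hZ, hcard.trans ?_⟩
  rw [mul_assoc, ← Real.exp_add]
  have hA' : 0 ≤ 8 * A + 2 := by linarith
  gcongr
  rw [← Real.exp_log (show (0 : ℝ) < 2 ^ ((k + 1).choose 2 + 9 * (k + 1) + 5) by positivity),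
    Real.log_pow]
  refine Real.exp_le_exp.2 ?_
  push_cast
  rw [Nat.cast_choose_two]
  push_cast
  set c := Real.log 2 with hc_def
  have hc : 0.69 < c := by have := Real.log_two_gt_d9; linarith
  have hc' : c < 0.7 := by have := Real.log_two_lt_d9; linarith
  set l := Real.log ((n : ℝ) + 1)
  have hkl : k * c ≤ l := by
    rw [hc_def, ← Real.log_pow]
    exact Real.log_le_log (by positivity) (by exact_mod_cast hk'.2)
  have hkc : 0 ≤ k * c := by positivity
  have h1 : k ^ 2 * c / 2 ≤ l ^ 2 / (2 * c) := by
    rw [div_le_div_iff₀ (by norm_num) (by positivity)]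
    nlinarith
  nlinarith

theorem ae_eventually_lt_foldOrbit {ε : ℝ} (hε : 0 < ε) :
    ∀ᵐ τ : ℝ ∂volume, ∀ᶠ n : ℕ in atTop,
      Real.exp (-(Real.log (n + 1) ^ 2 / (2 * Real.log 2)) -
        ε * (Real.log (n + 1) * Real.log (Real.log (n + 1)))) < foldOrbit 0 |τ| n := by
  have key : ∀ A : ℕ, ∀ᵐ τ : ℝ ∂volume, τ ∈ Set.Icc (-(A : ℝ)) A → ∀ᶠ n : ℕ in atTop,
      Real.exp (-(Real.log (n + 1) ^ 2 / (2 * Real.log 2)) -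
        ε * (Real.log (n + 1) * Real.log (Real.log (n + 1)))) < foldOrbit 0 |τ| n := by
    intro A
    set δ : ℕ → ℝ := fun n => Real.exp (-(Real.log (n + 1) ^ 2 / (2 * Real.log 2)) -
        ε * (Real.log (n + 1) * Real.log (Real.log (n + 1)))) with hδ
    have hlog : Tendsto (fun n : ℕ => Real.log ((n : ℝ) + 1)) atTop atTop :=
      Real.tendsto_log_atTop.comp (tendsto_atTop_add_const_right _ _ tendsto_natCast_atTop_atTop)
    obtain ⟨N, hN⟩ := eventually_atTop.1
      ((Real.tendsto_log_atTop.comp hlog).eventually_ge_atTop (12 / ε))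
    set C : ℝ := (8 * A + 2) * Real.exp 10 with hC
    have hC0 : 0 ≤ C := by positivity
    have hvol : ∀ n, volume {τ : ℝ | N ≤ n ∧ τ ∈ Set.Icc (-(A : ℝ)) A ∧ foldOrbit 0 |τ| n ≤ δ n} ≤
        ENNReal.ofReal (2 * C * (1 / ((n + 1 : ℕ) : ℝ) ^ 2)) := by
      intro n
      by_cases hn : N ≤ n
      swap
      · simp [hn]
      obtain ⟨Z, hZ, hcard⟩ := exists_hasCuts_exp (A := A) (Nat.cast_nonneg A) n
      refine (measure_mono fun τ hτ => hτ.2).trans ((hZ.volume_le (δ n)).trans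
        (ENNReal.ofReal_le_ofReal ?_))
      have hl : 0 ≤ Real.log ((n : ℝ) + 1) := Real.log_nonneg (by simp)
      have h1 : 12 ≤ ε * Real.log (Real.log ((n : ℝ) + 1)) := by
        have := hN n hn
        rw [div_le_iff₀ hε] at this
        simpa [mul_comm] using this
      have h2 : (Real.exp (Real.log ((n : ℝ) + 1) ^ 2 / (2 * Real.log 2) +
          10 * Real.log (n + 1))) * δ n ≤ 1 / ((n + 1 : ℕ) : ℝ) ^ 2 := by
        have h3 : 1 / ((n + 1 : ℕ) : ℝ) ^ 2 = Real.exp (-2 * Real.log (n + 1)) := by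
          rw [neg_mul, Real.exp_neg, mul_comm, Real.exp_mul, Real.exp_log (by positivity)]
          push_cast
          norm_num
        rw [h3, hδ, ← Real.exp_add]
        refine Real.exp_le_exp.2 ?_
        nlinarith
      have hδ0 : 0 < δ n := Real.exp_pos _
      calc (Z.card : ℝ) * (2 * δ n) ≤ (C * Real.exp (Real.log ((n : ℝ) + 1) ^ 2 / (2 * Real.log 2) +
            10 * Real.log (n + 1))) * (2 * δ n) := by gcongr
        _ = 2 * C * ((Real.exp (Real.log ((n : ℝ) + 1) ^ 2 / (2 * Real.log 2) +
          10 * Real.log (n + 1))) * δ n) := by ring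
        _ ≤ _ := by gcongr
    have hsum : (∑' n, volume {τ : ℝ | N ≤ n ∧ τ ∈ Set.Icc (-(A : ℝ)) A ∧
        foldOrbit 0 |τ| n ≤ δ n}) ≠ ⊤ := by
      have h1 : Summable fun n : ℕ => 2 * C * (1 / ((n + 1 : ℕ) : ℝ) ^ 2) :=
        (((summable_nat_add_iff 1).2 (Real.summable_one_div_nat_pow.2 one_lt_two))).mul_left _
      exact ne_top_of_le_ne_top h1.tsum_ofReal_ne_top (ENNReal.tsum_le_tsum hvol)
    filter_upwards [ae_eventually_notMem hsum] with τ hτ hτA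
    filter_upwards [hτ, eventually_ge_atTop N] with n hn hnN
    by_contra! hle
    exact hn ⟨hnN, hτA, hle⟩
  filter_upwards [ae_all_iff.2 key] with τ hτ
  obtain ⟨A, hA⟩ := exists_nat_ge |τ|
  exact hτ A (abs_le.1 hA)

/-! ### Upper bound for almost every target -/

theorem eventually_loglog_le {ε : ℝ} (hε : 0 < ε) :
    ∀ᶠ l : ℝ in atTop, l / Real.log 2 + (Real.log l + 4) ^ 2 / (2 * Real.log 2) ≤
      ε * (l * Real.log l) := by
  have hc : 0 < Real.log 2 := Real.log_pos one_lt_two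
  have h1 : ∀ᶠ l : ℝ in atTop, Real.log l ^ 2 ≤ l := by
    have := (Real.isLittleO_pow_log_id_atTop (n := 2)).bound one_pos
    filter_upwards [this, eventually_ge_atTop 0] with l hl hl0
    simpa [abs_of_nonneg hl0] using hl
  filter_upwards [h1, eventually_ge_atTop 1, Real.tendsto_log_atTop.eventually_ge_atTop 4,
    Real.tendsto_log_atTop.eventually_ge_atTop (3 / (ε * Real.log 2))] with l hl hl1 hl4 hlε
  rw [div_le_iff₀ (by positivity)] at hlε
  have h2 : (Real.log l + 4) ^ 2 ≤ 4 * l := by nlinarith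
  calc l / Real.log 2 + (Real.log l + 4) ^ 2 / (2 * Real.log 2)
      ≤ l / Real.log 2 + 4 * l / (2 * Real.log 2) := by gcongr
    _ = 3 * l / Real.log 2 := by field_simp; ring
    _ ≤ _ := by
      rw [div_le_iff₀ hc]
      nlinarith

theorem eventually_tailSum_le {ε : ℝ} (hε : 0 < ε) :
    ∀ᶠ n : ℕ in atTop, ∀ k, n + 1 ≤ regularTime k → tailSum k n ≤
      Real.exp (-(Real.log (n + 1) ^ 2 / (2 * Real.log 2)) +
        (1 / Real.log 2 + ε) * (Real.log (n + 1) * Real.log (Real.log (n + 1)))) := by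
  have hlog : Tendsto (fun n : ℕ => Real.log ((n : ℝ) + 1)) atTop atTop :=
    Real.tendsto_log_atTop.comp (tendsto_atTop_add_const_right _ _ tendsto_natCast_atTop_atTop)
  filter_upwards [hlog.eventually (eventually_loglog_le hε), hlog.eventually_ge_atTop 1,
    eventually_ge_atTop 4] with n hn hl1 hn4 k' hk'
  classical
  have hex : ∃ k, n + 1 ≤ regularTime k := ⟨k', hk'⟩
  obtain ⟨k, hk, hmin⟩ : ∃ k, n + 1 ≤ regularTime k ∧ ∀ j < k, ¬ n + 1 ≤ regularTime j :=
    ⟨Nat.find hex, Nat.find_spec hex, fun j hj => Nat.find_min hex hj⟩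
  have hkk' : k ≤ k' := by
    by_contra! h
    exact hmin k' h hk'
  obtain ⟨i, rfl⟩ : ∃ i, k = i + 1 := by
    cases k with
    | zero => simp only [regularTime] at hk; omega
    | succ i => exact ⟨i, rfl⟩
  have hi := not_le.1 (hmin i (by omega))
  refine (tailSum_antitone_left n hkk').trans ((tailSum_le _ n).trans ((tmDiff_le _ n).trans ?_))
  set c := Real.log 2 with hc_def
  have hc : 0.69 < c := by have := Real.log_two_gt_d9; linarith
  have hc' : c < 0.7 := by have := Real.log_two_lt_d9; linarith
  set l := Real.log ((n : ℝ) + 1) with hl_def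
  set k : ℕ := i + 1 with hk_def
  have hk1 : (1 : ℝ) ≤ k := by exact_mod_cast (by omega : 1 ≤ k)
  have hkc : k * c ≤ l := by
    rw [hc_def, hl_def, ← Real.log_pow]
    refine Real.log_le_log (by positivity) ?_
    have h : 2 ^ k ≤ n + 1 := by
      refine le_trans ?_ hi.le
      simp only [regularTime, hk_def]
      calc 2 ^ (i + 1) = 1 * 2 ^ (i + 1) := by ring
        _ ≤ (i + 1) * 2 ^ (i + 2) := by gcongr <;> omega
    exact_mod_cast h
  have hkl : l ≤ Real.log (k + 1) + (k + 2) * c := by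
    have h : (n : ℝ) + 1 ≤ (k + 1) * 2 ^ (k + 2) := by exact_mod_cast hk
    calc l ≤ Real.log ((k + 1) * 2 ^ (k + 2)) := Real.log_le_log (by positivity) h
      _ = _ := by
        rw [Real.log_mul (by positivity) (by positivity), Real.log_pow]
        push_cast
        ring
  have hkl' : (k : ℝ) ≤ l / c := by rw [le_div_iff₀ (by linarith)]; exact hkc
  have hlogk1 : Real.log (k + 1) ≤ Real.log l + 2 := by
    have h1 : (k : ℝ) ≤ 2 * l := by nlinarith
    have h2 : Real.log (k + 1) ≤ Real.log (3 * l) := Real.log_le_log (by positivity) (by linarith)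
    rw [Real.log_mul (by norm_num) (by linarith)] at h2
    have h3 := Real.log_le_sub_one_of_pos (show (0 : ℝ) < 3 by norm_num)
    linarith
  have hlogk : Real.log k ≤ Real.log l + 1 := by
    have h1 : Real.log k ≤ Real.log (2 * l) :=
      Real.log_le_log (by linarith) (by nlinarith)
    rw [Real.log_mul (by norm_num) (by linarith)] at h1
    linarith
  have hlogl : 0 ≤ Real.log l := Real.log_nonneg hl1
  have hd : (l - k * c) ^ 2 ≤ (Real.log l + 4) ^ 2 := by
    refine pow_le_pow_left₀ (by linarith) ?_ 2
    linarith
  have hnum : (2 : ℝ) ^ k.choose 2 * k ! / ((n : ℝ) + 1) ^ (k + 1) ≤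
      Real.exp (c * k ^ 2 / 2 + k * Real.log k - k * l) := by
    have h1 : (2 : ℝ) ^ k.choose 2 ≤ Real.exp (c * k ^ 2 / 2) := by
      rw [← Real.exp_log (show (0 : ℝ) < 2 ^ k.choose 2 by positivity), Real.log_pow]
      refine Real.exp_le_exp.2 ?_
      rw [Nat.cast_choose_two]
      nlinarith
    have h2 : (k ! : ℝ) ≤ Real.exp (k * Real.log k) := by
      rw [Real.exp_nat_mul, Real.exp_log (by linarith)]
      exact_mod_cast Nat.factorial_le_pow k
    have h3 : Real.exp (k * l) ≤ ((n : ℝ) + 1) ^ (k + 1) := by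
      rw [Real.exp_nat_mul, hl_def, Real.exp_log (by positivity)]
      exact pow_le_pow_right₀ (by simp) (by omega)
    rw [Real.exp_sub, Real.exp_add]
    gcongr
  refine hnum.trans (Real.exp_le_exp.2 ?_)
  have h1 : (k : ℝ) * Real.log k ≤ l / c * (Real.log l + 1) :=
    mul_le_mul hkl' hlogk (Real.log_nonneg hk1) (div_nonneg (by linarith) (by linarith))
  have h2 : c * k ^ 2 / 2 - k * l = -(l ^ 2 / (2 * c)) + (l - k * c) ^ 2 / (2 * c) := by
    field_simp
    ring
  have h3 : (l - k * c) ^ 2 / (2 * c) ≤ (Real.log l + 4) ^ 2 / (2 * c) := by gcongr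
  have h4 : (1 / c + ε) * (l * Real.log l) = l / c * Real.log l + ε * (l * Real.log l) := by ring
  linarith

theorem ae_frequently_foldOrbit_le {ε : ℝ} (hε : 0 < ε) :
    ∀ᵐ τ : ℝ ∂volume, ∃ᶠ n : ℕ in atTop, foldOrbit 0 |τ| n ≤
      Real.exp (-(Real.log (n + 1) ^ 2 / (2 * Real.log 2)) +
        (1 / Real.log 2 + ε) * (Real.log (n + 1) * Real.log (Real.log (n + 1)))) := by
  filter_upwards [ae_frequently_le_tailSum] with τ hτ
  have h : ∃ᶠ n : ℕ in atTop, ∃ k, n + 1 ≤ regularTime k ∧ foldOrbit 0 |τ| n ≤ tailSum k n :=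
    frequently_atTop.2 hτ
  refine (h.and_eventually (eventually_tailSum_le hε)).mono ?_
  rintro n ⟨⟨k, hk, h1⟩, h2⟩
  exact h1.trans (h2 k hk)

/-! ### The limits inferior -/

theorem coe_le_liminf {u : ℕ → ℝ} {a : ℝ} (h : ∀ η > 0, ∀ᶠ n in atTop, a - η ≤ u n) :
    (a : EReal) ≤ liminf (fun n => (u n : EReal)) atTop := by
  refine le_of_forall_lt fun b hb => ?_
  obtain ⟨r, hbr, hra⟩ := EReal.lt_iff_exists_real_btwn.1 hb
  refine hbr.trans_le (le_liminf_of_le (by isBoundedDefault) ?_)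
  filter_upwards [h (a - r) (sub_pos.2 (EReal.coe_lt_coe_iff.1 hra))] with n hn
  exact EReal.coe_le_coe_iff.2 (by linarith)

theorem liminf_le_coe {u : ℕ → ℝ} {a : ℝ} (h : ∀ η > 0, ∃ᶠ n in atTop, u n ≤ a + η) :
    liminf (fun n => (u n : EReal)) atTop ≤ (a : EReal) := by
  refine le_of_forall_gt fun b hb => ?_
  obtain ⟨r, har, hrb⟩ := EReal.lt_iff_exists_real_btwn.1 hb
  refine lt_of_le_of_lt (liminf_le_of_frequently_le' ?_) hrb
  refine (h (r - a) (sub_pos.2 (EReal.coe_lt_coe_iff.1 har))).mono fun n hn => ?_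
  exact EReal.coe_le_coe_iff.2 (by linarith)

/-- Replacing `log n` by `log (n + 1)` and adding a multiple of `log n * log (log n)` does not change
the leading term `(log n) ^ 2`. -/
theorem eventually_log_sq_add_le {C a η : ℝ} (hC : 0 ≤ C) (ha : 0 ≤ a) (hη : 0 < η) :
    ∀ᶠ n : ℕ in atTop, a * Real.log (n + 1) ^ 2 +
      C * (Real.log (n + 1) * Real.log (Real.log (n + 1))) ≤ (a + η) * Real.log n ^ 2 := by
  have hlog : Tendsto (fun n : ℕ => Real.log (n : ℝ)) atTop atTop :=
    Real.tendsto_log_atTop.comp tendsto_natCast_atTop_atTop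
  have hlog' : Tendsto (fun n : ℕ => Real.log ((n : ℝ) + 1)) atTop atTop :=
    Real.tendsto_log_atTop.comp (tendsto_atTop_add_const_right _ _ tendsto_natCast_atTop_atTop)
  have h1 : ∀ᶠ l : ℝ in atTop, Real.log l ≤ η / (8 * (C + 1)) * l := by
    have := Real.isLittleO_log_id_atTop.bound (show 0 < η / (8 * (C + 1)) by positivity)
    filter_upwards [this, eventually_ge_atTop 0] with l hl hl0
    have h2 := (le_abs_self _).trans hl
    simpa [abs_of_nonneg hl0] using h2
  filter_upwards [hlog'.eventually h1, hlog.eventually_ge_atTop 1,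
    hlog.eventually_ge_atTop (6 * a / η), eventually_ge_atTop 1] with n h2 hp1 hpη hn
  have hn' : (1 : ℝ) ≤ n := by exact_mod_cast hn
  set p := Real.log (n : ℝ)
  set l := Real.log ((n : ℝ) + 1)
  have hl : l ≤ p + 1 := by
    have : l ≤ Real.log (2 * n) := Real.log_le_log (by positivity) (by linarith)
    rw [Real.log_mul (by norm_num) (by positivity)] at this
    linarith [Real.log_two_lt_d9]
  have hl0 : 0 ≤ l := Real.log_nonneg (by linarith)
  have h3 : l ^ 2 ≤ p ^ 2 + 3 * p := by nlinarith
  rw [div_le_iff₀ hη] at hpη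
  have h4 : a * l ^ 2 ≤ a * p ^ 2 + η / 2 * p ^ 2 := by
    have : a * l ^ 2 ≤ a * (p ^ 2 + 3 * p) := by gcongr
    nlinarith
  have h5 : C * (l * Real.log l) ≤ η / 2 * p ^ 2 :=
    calc C * (l * Real.log l) ≤ (C + 1) * (l * (η / (8 * (C + 1)) * l)) := by
          refine (mul_le_mul_of_nonneg_left (mul_le_mul_of_nonneg_left h2 hl0) hC).trans ?_
          gcongr
          linarith
      _ = η / 8 * l ^ 2 := by field_simp
      _ ≤ η / 8 * (4 * p ^ 2) := by gcongr; nlinarith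
      _ = _ := by ring
  linarith

theorem mainTheorem2 :
    ∀ᵐ τ : ℝ ∂volume,
      -- the limit inferior is taken in the extended reals, so that it has no default value
      liminf (fun n : ℕ =>
          ((Real.log |τ - greedySum τ n| / (Real.log n) ^ 2 : ℝ) : EReal)) atTop
        = ((-(1 / Real.log 4) : ℝ) : EReal) ∧
      -- the stronger form, with the second-order term
      0 ≤ liminf (fun m : ℕ =>
          (((Real.log |τ - greedySum τ (m - 1)| + 1 / Real.log 4 * (Real.log m) ^ 2) /
            (Real.log m * Real.log (Real.log m)) : ℝ) : EReal)) atTop ∧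
      liminf (fun m : ℕ =>
          (((Real.log |τ - greedySum τ (m - 1)| + 1 / Real.log 4 * (Real.log m) ^ 2) /
            (Real.log m * Real.log (Real.log m)) : ℝ) : EReal)) atTop
        ≤ ((1 / Real.log 2 : ℝ) : EReal) := by
  have hc : 0 < Real.log 2 := Real.log_pos one_lt_two
  have h4 : Real.log 4 = 2 * Real.log 2 := by
    rw [show (4 : ℝ) = 2 ^ 2 by norm_num, Real.log_pow]
    norm_num
  have hlog : Tendsto (fun n : ℕ => Real.log (n : ℝ)) atTop atTop :=
    Real.tendsto_log_atTop.comp tendsto_natCast_atTop_atTop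
  have hloglog : Tendsto (fun n : ℕ => Real.log (Real.log (n : ℝ))) atTop atTop :=
    Real.tendsto_log_atTop.comp hlog
  -- `η = 1 / (i + 1)` makes the exceptional sets countable in number
  have hlow := ae_all_iff.2 fun i : ℕ => ae_eventually_lt_foldOrbit (Nat.one_div_pos_of_nat (n := i))
  have hupp := ae_all_iff.2 fun i : ℕ => ae_frequently_foldOrbit_le (Nat.one_div_pos_of_nat (n := i))
  filter_upwards [hlow, hupp] with τ hlow hupp
  simp only [abs_sub_greedySum, h4]
  have hpos : ∀ᶠ n : ℕ in atTop, 0 < foldOrbit 0 |τ| n := by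
    filter_upwards [hlow 0] with n hn
    exact (Real.exp_pos _).trans hn
  replace hlow : ∀ η > 0, ∀ᶠ n : ℕ in atTop, -(Real.log (n + 1) ^ 2 / (2 * Real.log 2)) -
      η * (Real.log (n + 1) * Real.log (Real.log (n + 1))) ≤ Real.log (foldOrbit 0 |τ| n) := by
    intro η hη
    obtain ⟨i, hi⟩ := exists_nat_one_div_lt hη
    filter_upwards [hlow i, (tendsto_add_atTop_iff_nat 1).2 hlog |>.eventually_ge_atTop 0,
      (tendsto_add_atTop_iff_nat 1).2 hloglog |>.eventually_ge_atTop 0] with n hn h1 h2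
    push_cast at h1 h2
    rw [← Real.log_exp (_ - _)]
    refine Real.log_le_log (Real.exp_pos _) (le_trans (Real.exp_le_exp.2 ?_) hn.le)
    gcongr
  replace hupp : ∀ η > 0, ∃ᶠ n : ℕ in atTop, Real.log (foldOrbit 0 |τ| n) ≤
      -(Real.log (n + 1) ^ 2 / (2 * Real.log 2)) +
      (1 / Real.log 2 + η) * (Real.log (n + 1) * Real.log (Real.log (n + 1))) := by
    intro η hη
    obtain ⟨i, hi⟩ := exists_nat_one_div_lt hη
    refine ((hupp i).and_eventually (hpos.and
      (((tendsto_add_atTop_iff_nat 1).2 hlog |>.eventually_ge_atTop 0).and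
      ((tendsto_add_atTop_iff_nat 1).2 hloglog |>.eventually_ge_atTop 0)))).mono ?_
    rintro n ⟨hn, h0, h1, h2⟩
    push_cast at h1 h2
    refine ((Real.log_le_log h0 hn).trans_eq (Real.log_exp _)).trans ?_
    gcongr
  refine ⟨le_antisymm (liminf_le_coe fun η hη => ?_) (coe_le_liminf fun η hη => ?_), ?_, ?_⟩
  · have h1 := eventually_log_sq_add_le (C := 1 / Real.log 2 + 1) (a := 0) (by positivity) le_rfl hη
    refine ((hupp 1 one_pos).and_eventually (h1.and ((hlog.eventually_gt_atTop 0).and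
      (eventually_ge_atTop 1)))).mono ?_
    rintro n ⟨h2, h3, h5, h6⟩
    have h6' : (1 : ℝ) ≤ n := by exact_mod_cast h6
    rw [div_le_iff₀ (by positivity)]
    have h7 : Real.log n ^ 2 ≤ Real.log (n + 1) ^ 2 :=
      pow_le_pow_left₀ h5.le (Real.log_le_log (by linarith) (by linarith)) 2
    have h8 : Real.log n ^ 2 / (2 * Real.log 2) ≤ Real.log (n + 1) ^ 2 / (2 * Real.log 2) := by
      gcongr
    have h9 : (-(1 / (2 * Real.log 2)) + η) * Real.log n ^ 2 =
      -(Real.log n ^ 2 / (2 * Real.log 2)) + η * Real.log n ^ 2 := by ring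
    linarith
  · have h1 := eventually_log_sq_add_le (C := 1) (a := 1 / (2 * Real.log 2)) zero_le_one
      (by positivity) hη
    filter_upwards [hlow 1 one_pos, h1, hlog.eventually_gt_atTop 0] with n h2 h3 h5
    rw [le_div_iff₀ (by positivity)]
    have h9 : Real.log (n + 1) ^ 2 / (2 * Real.log 2) =
      1 / (2 * Real.log 2) * Real.log (n + 1) ^ 2 := by ring
    linarith
  · refine coe_le_liminf (a := 0) fun η hη => ?_
    filter_upwards [(tendsto_sub_atTop_nat 1).eventually (hlow η hη), eventually_ge_atTop 1,
      hlog.eventually_gt_atTop 0, hloglog.eventually_gt_atTop 0] with m h1 hm h2 h3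
    have hm' : ((m - 1 : ℕ) : ℝ) + 1 = m := by exact_mod_cast Nat.sub_add_cancel hm
    rw [hm'] at h1
    rw [le_div_iff₀ (by positivity)]
    have h5 : Real.log m ^ 2 / (2 * Real.log 2) = 1 / (2 * Real.log 2) * Real.log m ^ 2 := by ring
    linarith
  · refine liminf_le_coe fun η hη => (tendsto_add_atTop_nat 1).frequently ?_
    refine ((hupp η hη).and_eventually
      (((tendsto_add_atTop_iff_nat 1).2 hlog |>.eventually_gt_atTop 0).and
      ((tendsto_add_atTop_iff_nat 1).2 hloglog |>.eventually_gt_atTop 0))).mono ?_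
    rintro n ⟨h1, h2, h3⟩
    rw [Nat.add_sub_cancel, div_le_iff₀ (by positivity)]
    push_cast
    have h5 : Real.log ((n : ℝ) + 1) ^ 2 / (2 * Real.log 2) =
      1 / (2 * Real.log 2) * Real.log (n + 1) ^ 2 := by ring
    linarith
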